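/- Let $H=\{(1,y,z): y\ge 0,\ y^2+z^2=1\}\subset\mathbb{R}^3$ be the unit half-circle in the plane $x=1$ with diameter from $(1,0,-1)$ to $(1,0,1)$, let $-H$ be its reflection in the origin (a half-circle in the plane $x=-1$), and let $K=\operatorname{conv}(H\cup -H)$. Then $K$ is a convex body symmetric about the origin. Let $\|\cdot\|$ be the norm with unit ball $K$, let $S=\{\mathbf y:\|\mathbf y\|=1\}$, and let $\mathbf{x}=(1,0,0)$; then $\mathbf x\in S$. Let $B=\{\mathbf p\in\mathbb{R}^3: \|\mathbf p+\mathbf x\|=\|\mathbf p-\mathbf x\|\}$ be the bisector of $-\mathbf x$ and $\mathbf x$ (its points are called ordinary). Compactify $\mathbb{R}^3$ to a closed ball by adding an ideal point $\infty\mathbf u$ for each Euclidean unit vector $\mathbf u$; the ideal points of the bisector are those $\infty\mathbf u$ for which there are $t_i\to\infty$ and $\mathbf v_i\to\mathbf u$ with $t_i\mathbf v_i\in B$ for all $i$. The closed bisector $\overline B$ is $B$ together with its ideal points, as a subspace of this closed ball. The bounded representation of the bisector is the image of $\overline B$ under the map $\Phi$ with $\Phi(\mathbf p)=\mathbf p/\|\mathbf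 p-\mathbf x\|$ for $\mathbf p\in B$ and $\Phi(\infty\mathbf u)=\mathbf u/\|\mathbf u\|$ for ideal points. The radial projection $P(\mathbf x)$ is the set of $\mathbf y\in S$ such that $t\mathbf y\in B$ for some real $t>0$; the extended radial projection contains in addition the points $\mathbf u/\|\mathbf u\|$ for the ideal points $\infty\mathbf u$ of the bisector. Then: 1. $B$ is a topological 2-manifold, and the closed bisector $\overline B$ is a topological 2-manifold with non-empty boundary, the boundary being the set of its ideal points. 2. The bounded representation of the bisector is homeomorphic to the closed disc. 3. Neither $P(\mathbf x)$ nor the extended radial projection is a topological manifold, of any dimension, with or without boundary. -/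

import Mathlib

open Set Filter Topology Metric

noncomputable section

namespace MinkowskiBisector

section General

variable {V : Type*} [NormedAddCommGroup V] [InnerProductSpace ℝ V]

/-- The unit sphere of the norm whose unit ball is `K`. The norm itself is `gauge K`,
the Minkowski functional of `K`. -/
def unitSphere (K : Set V) : Set V := {y | gauge K y = 1}

/-- The bisector of `-x` and `x` (its ordinary points): the vectors that are
isosceles orthogonal to `x`. -/
def bisector (K : Set V) (x : V) : Set V :=
  {p | gauge K (p + x) = gauge K (p - x)}

/-- The ideal points of the bisector, given by Euclidean unit vectors `u` (standing for `∞ u`):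
`u` is a limit of vectors `v i` such that `t i • v i` lies in the bisector and `t i → ∞`. -/
def idealPoints (K : Set V) (x : V) : Set V :=
  {u | ‖u‖ = 1 ∧ ∃ (t : ℕ → ℝ) (v : ℕ → V),
    (∀ i, t i • v i ∈ bisector K x) ∧ Tendsto t atTop atTop ∧ Tendsto v atTop (𝓝 u)}

/-- The bisector together with its ideal points, in the compactification of `V` to the closed
Euclidean unit ball: `V` is embedded as the open ball by the radial homeomorphism
`p ↦ p / √(1 + ‖p‖²)`, and the points of the boundary sphere are the ideal points. -/
def closedBisector (K : Set V) (x : V) : Set V :=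
  (OpenPartialHomeomorph.univUnitBall : OpenPartialHomeomorph V V) '' bisector K x
    ∪ idealPoints K x

/-- The radial projection `P(x)` of the ordinary bisector. -/
def radialProjection (K : Set V) (x : V) : Set V :=
  {y | y ∈ unitSphere K ∧ ∃ t : ℝ, 0 < t ∧ t • y ∈ bisector K x}

/-- The radial projection of the bisector extended by its ideal points
(that is, `t = ∞` is allowed). -/
def closedRadialProjection (K : Set V) (x : V) : Set V :=
  radialProjection K x ∪ {y | y ∈ unitSphere K ∧ ‖y‖⁻¹ • y ∈ idealPoints K x}

/-- The bounded representation of the bisector: an ordinary point `p` is sent to `p / t` where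
`p ∈ (t S + x) ∩ (t S - x)`, i.e. `t` is the common distance of `p` from `x` and `-x`; an ideal
point is sent to its radial projection to the unit sphere. -/
def boundedRepresentation (K : Set V) (x : V) : Set V :=
  (fun p => (gauge K (p - x))⁻¹ • p) '' bisector K x
    ∪ (fun u => (gauge K u)⁻¹ • u) '' idealPoints K x

end General

section Manifolds

/-- `M` is a topological manifold (without boundary) of dimension `d`. -/
def IsTopManifold (d : ℕ) (M : Type*) [TopologicalSpace M] : Prop :=
  T2Space M ∧ SecondCountableTopology M ∧
    Nonempty (ChartedSpace (EuclideanSpace ℝ (Fin d)) M)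

/-- `M` is a topological manifold with boundary, of dimension `d ≥ 1`, and its boundary is the
(possibly empty) set `bd`. -/
def IsTopManifoldWithBoundary (d : ℕ) [NeZero d] (M : Type*) [TopologicalSpace M]
    (bd : Set M) : Prop :=
  T2Space M ∧ SecondCountableTopology M ∧
    ∃ _ : ChartedSpace (EuclideanHalfSpace d) M,
      (modelWithCornersEuclideanHalfSpace d).boundary M = bd

/-- `M` is a topological manifold of some dimension, with or without boundary. -/
def IsTopManifoldOfSomeKind (M : Type*) [TopologicalSpace M] : Prop :=
  (∃ d : ℕ, IsTopManifold d M) ∨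
    ∃ (d : ℕ) (_ : NeZero d) (bd : Set M), IsTopManifoldWithBoundary d M bd

end Manifolds

/-- The unit half-circle in the plane `x = 1` with diameter from `(1,0,-1)` to `(1,0,1)`,
on the side `y ≥ 0`. -/
def halfCircle : Set (EuclideanSpace ℝ (Fin 3)) :=
  {p | p 0 = 1 ∧ 0 ≤ p 1 ∧ p 1 ^ 2 + p 2 ^ 2 = 1}

/-- The half-circle symmetric to `halfCircle` with respect to the origin, in the plane `x = -1`. -/
def oppositeHalfCircle : Set (EuclideanSpace ℝ (Fin 3)) :=
  {p | p 0 = -1 ∧ p 1 ≤ 0 ∧ p 1 ^ 2 + p 2 ^ 2 = 1}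

/-- The convex hull of the two half-circles. -/
def body : Set (EuclideanSpace ℝ (Fin 3)) :=
  convexHull ℝ (halfCircle ∪ oppositeHalfCircle)

/-- The vector `(1,0,0)`. -/
def direction : EuclideanSpace ℝ (Fin 3) := !₂[(1 : ℝ), 0, 0]

end MinkowskiBisector

end

namespace MinkowskiBisector

open scoped Pointwise

/-! Everything rests on an explicit equation for the bisector. A point of `l • body` is a sum of
points of two half-discs with radii `a`, `b`, where `a + b = l` and `a - b = x`. Optimizing over the
summands gives the norm on `y ≥ 0` in closed form (`gauge_body_of_nonneg`), and central symmetry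
covers `y ≤ 0`. The bisector is then the graph `y = fold x (max (|z| - 1) 0)` over the whole `(x,
z)`-plane (`mem_bisector_iff`): flat on the two wedges `|x| ≤ |z| - 1` and curved elsewhere. So it
is a topological plane.

Replacing `1` by `r` makes the equation homogeneous in `(r, p)`; this is `OnCone`. The value `r = 0`
describes the ideal points, and each compactification amounts to a choice of `r`: `√(1 - ‖q‖²)` in
the ball model, and `1 - |x|` in the bounded representation, because the common distance is `max
(|x| + 1) |z|`. The first gives a closed disc whose boundary circle consists of the ideal points,
the second a graph over a square, again a disc.

For the radial projection `r` is free. Since `fold 0 m = 0` for every `m`, the only point of the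
projection with `x = 0` and `z > 0` is `(0, 0, 1)`, and points with `x > 0` and with `x < 0`
accumulate there: it is a local cut point, impossible in dimension at least two. The projection also
contains a two-dimensional patch, impossible in dimension at most one. -/

/-! ### The two half-discs and the dilates of the body -/

lemma convex_halfDisc (s c : ℝ) :
    Convex ℝ {p : EuclideanSpace ℝ (Fin 3) | p 0 = c ∧ 0 ≤ s * p 1 ∧ p 1 ^ 2 + p 2 ^ 2 ≤ 1} := by
  rintro p ⟨hp0, hp1, hp2⟩ q ⟨hq0, hq1, hq2⟩ a b ha hb hab
  refine ⟨?_, ?_, ?_⟩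
  · simp only [PiLp.add_apply, PiLp.smul_apply, smul_eq_mul, hp0, hq0]
    rw [← add_mul, hab, one_mul]
  · simp only [PiLp.add_apply, PiLp.smul_apply, smul_eq_mul]
    nlinarith [mul_nonneg ha hp1, mul_nonneg hb hq1]
  · simp only [PiLp.add_apply, PiLp.smul_apply, smul_eq_mul]
    obtain rfl : b = 1 - a := by linarith
    nlinarith [mul_nonneg (mul_nonneg ha hb) (add_nonneg (sq_nonneg (p 1 - q 1))
      (sq_nonneg (p 2 - q 2))), mul_le_mul_of_nonneg_left hp2 ha, mul_le_mul_of_nonneg_left hq2 hb]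

lemma mem_convexHull_of_vertical {A : Set (EuclideanSpace ℝ (Fin 3))} {x y z : ℝ}
    (h : y ^ 2 + z ^ 2 ≤ 1) (h1 : !₂[x, y, √(1 - y ^ 2)] ∈ A) (h2 : !₂[x, y, -√(1 - y ^ 2)] ∈ A) :
    !₂[x, y, z] ∈ convexHull ℝ A := by
  have hs : z ^ 2 ≤ √(1 - y ^ 2) ^ 2 := by
    rw [Real.sq_sqrt (by nlinarith [sq_nonneg z])]; linarith
  have hz := abs_le.1 (abs_le_of_sq_le_sq hs (Real.sqrt_nonneg _))
  set r := √(1 - y ^ 2)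
  rcases (Real.sqrt_nonneg (1 - y ^ 2)).eq_or_lt with hr | hr
  · have : z = r := by
      have : r = 0 := hr.symm
      linarith [hz.1, hz.2]
    rw [this]; exact subset_convexHull ℝ _ h1
  · have hr' : 0 < r := hr
    have := (convex_convexHull ℝ A) (subset_convexHull ℝ _ h1) (subset_convexHull ℝ _ h2)
      (a := (r + z) / (2 * r)) (b := (r - z) / (2 * r))
      (div_nonneg (by linarith [hz.1]) (by linarith)) (div_nonneg (by linarith [hz.2]) (by linarith))
      (by field_simp; ring)
    convert this using 1
    ext i
    fin_cases i <;> simp <;> field_simp <;> ring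

lemma convexHull_halfCircle : convexHull ℝ halfCircle =
    {p | p 0 = 1 ∧ 0 ≤ p 1 ∧ p 1 ^ 2 + p 2 ^ 2 ≤ 1} := by
  apply Subset.antisymm
  · refine convexHull_min ?_ (by simpa using convex_halfDisc 1 1)
    rintro p ⟨h0, h1, h2⟩
    exact ⟨h0, h1, h2.le⟩
  · rintro p ⟨h0, h1, h2⟩
    have hr : √(1 - p 1 ^ 2) ^ 2 = 1 - p 1 ^ 2 :=
      Real.sq_sqrt (by nlinarith [sq_nonneg (p 2)])
    have : p = !₂[1, p 1, p 2] := by ext i; fin_cases i <;> simp [h0]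
    rw [this]
    refine mem_convexHull_of_vertical h2 ⟨?_, ?_, ?_⟩ ⟨?_, ?_, ?_⟩ <;> simp [h1, hr]

lemma convexHull_oppositeHalfCircle : convexHull ℝ oppositeHalfCircle =
    {p | p 0 = -1 ∧ p 1 ≤ 0 ∧ p 1 ^ 2 + p 2 ^ 2 ≤ 1} := by
  apply Subset.antisymm
  · refine convexHull_min ?_ (by simpa using convex_halfDisc (-1) (-1))
    rintro p ⟨h0, h1, h2⟩
    exact ⟨h0, h1, h2.le⟩
  · rintro p ⟨h0, h1, h2⟩
    have hr : √(1 - p 1 ^ 2) ^ 2 = 1 - p 1 ^ 2 :=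
      Real.sq_sqrt (by nlinarith [sq_nonneg (p 2)])
    have : p = !₂[-1, p 1, p 2] := by ext i; fin_cases i <;> simp [h0]
    rw [this]
    refine mem_convexHull_of_vertical h2 ⟨?_, ?_, ?_⟩ ⟨?_, ?_, ?_⟩ <;> simp [h1, hr]

lemma halfCircle_nonempty : halfCircle.Nonempty :=
  ⟨!₂[1, 1, 0], by refine ⟨?_, ?_, ?_⟩ <;> simp⟩

lemma oppositeHalfCircle_nonempty : oppositeHalfCircle.Nonempty :=
  ⟨!₂[-1, -1, 0], by refine ⟨?_, ?_, ?_⟩ <;> simp⟩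

lemma body_eq_convexJoin :
    body = convexJoin ℝ (convexHull ℝ halfCircle) (convexHull ℝ oppositeHalfCircle) :=
  convexHull_union halfCircle_nonempty oppositeHalfCircle_nonempty

/-- Membership in a dilate of the body: the point is a sum of points of the dilates, by
factors `a` and `b` with `a + b = l`, of the two half-discs. -/
lemma mem_smul_body_iff {l : ℝ} (hl : 0 < l) {p : EuclideanSpace ℝ (Fin 3)} :
    p ∈ l • body ↔ ∃ a b y₁ z₁ y₂ z₂ : ℝ, 0 ≤ a ∧ 0 ≤ b ∧ a + b = l ∧ a - b = p 0 ∧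
      0 ≤ y₁ ∧ y₁ ^ 2 + z₁ ^ 2 ≤ a ^ 2 ∧ 0 ≤ y₂ ∧ y₂ ^ 2 + z₂ ^ 2 ≤ b ^ 2 ∧
      p 1 = y₁ - y₂ ∧ p 2 = z₁ + z₂ := by
  rw [body_eq_convexJoin, convexHull_halfCircle, convexHull_oppositeHalfCircle]
  constructor
  · rintro ⟨q, hq, rfl⟩
    obtain ⟨h, ⟨h0, h1, h2⟩, k, ⟨k0, k1, k2⟩, a, b, ha, hb, hab, rfl⟩ := mem_convexJoin.1 hq
    refine ⟨l * a, l * b, l * a * h 1, l * a * h 2, -(l * b * k 1), l * b * k 2,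
      by positivity, by positivity, by rw [← mul_add, hab, mul_one], ?_, by positivity, ?_,
      ?_, ?_, ?_, ?_⟩
    · simp [h0, k0]; ring
    · nlinarith [mul_le_mul_of_nonneg_left h2 (sq_nonneg (l * a))]
    · nlinarith [mul_nonneg (mul_nonneg hl.le hb) (neg_nonneg.2 k1)]
    · nlinarith [mul_le_mul_of_nonneg_left k2 (sq_nonneg (l * b))]
    · simp; ring
    · simp; ring
  · rintro ⟨a, b, y₁, z₁, y₂, z₂, ha, hb, hab, h0, hy₁, h₁, hy₂, h₂, hp1, hp2⟩
    -- A disc of radius `c = 0` causes no trouble: the bound forces `y = z = 0`, and division by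
    -- zero returns `0`.
    have key : ∀ {c y z : ℝ}, 0 ≤ c → y ^ 2 + z ^ 2 ≤ c ^ 2 →
        c * (y / c) = y ∧ c * (z / c) = z ∧ (y / c) ^ 2 + (z / c) ^ 2 ≤ 1 := by
      intro c y z hc h
      rcases hc.eq_or_lt with rfl | hc
      · have hy : y = 0 := by nlinarith [sq_nonneg y, sq_nonneg z]
        have hz : z = 0 := by nlinarith [sq_nonneg y, sq_nonneg z]
        simp [hy, hz]
      · refine ⟨by field_simp, by field_simp, ?_⟩
        rw [div_pow, div_pow, ← add_div]
        exact div_le_one_of_le₀ h (sq_nonneg c)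
    obtain ⟨e₁, e₂, e₃⟩ := key ha h₁
    obtain ⟨f₁, f₂, f₃⟩ := key hb h₂
    refine ⟨l⁻¹ • p, mem_convexJoin.2 ⟨!₂[1, y₁ / a, z₁ / a], ⟨by simp, ?_, by simpa using e₃⟩,
      !₂[-1, -(y₂ / b), z₂ / b], ⟨by simp, ?_, by simpa using f₃⟩, a / l, b / l, by positivity,
      by positivity, by rw [← add_div, hab, div_self hl.ne'], ?_⟩, ?_⟩
    · simpa using div_nonneg hy₁ ha
    · simpa using div_nonneg hy₂ hb
    · ext i
      fin_cases i
      · simp [← h0]; field_simp; ring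
      · simp [hp1, div_mul_eq_mul_div, e₁, f₁]; field_simp; ring
      · simp [hp2, div_mul_eq_mul_div, e₂, f₂]; field_simp
    · simp [smul_smul, hl.ne']

/-! ### The norm in closed form -/

/-- The values of the norm on the half-space `0 ≤ y`. -/
noncomputable def upperNorm (x y w : ℝ) : ℝ :=
  if x + w ≤ y then 2 * y - x else max x (w + y ^ 2 / (x + w))

lemma upperNorm_nonneg {x y w : ℝ} (hy : 0 ≤ y) (hw : 0 ≤ w) : 0 ≤ upperNorm x y w := by
  unfold upperNorm
  split_ifs with h
  · linarith
  · exact le_max_of_le_right (add_nonneg hw (div_nonneg (sq_nonneg _) (by linarith)))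

/-- The two branches record which constraint on `l` is binding. With `a = (l + x) / 2` and `b = (l -
x) / 2`: if `w ≤ b`, only `y ≤ a` matters, which is `2 * y - x ≤ l`; otherwise squaring `w - b ≤
√(a² - y²)` gives `y² ≤ (l - w) * (x + w)`. -/
lemma upperNorm_le_iff {x y w l : ℝ} (hy : 0 ≤ y) (hw : 0 ≤ w) :
    upperNorm x y w ≤ l ↔ |x| ≤ l ∧ y ≤ (l + x) / 2 ∧
      w ≤ (l - x) / 2 + √(((l + x) / 2) ^ 2 - y ^ 2) := by
  unfold upperNorm
  split_ifs with h
  · constructor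
    · intro hl
      refine ⟨abs_le.2 ⟨by linarith, by linarith⟩, by linarith, ?_⟩
      linarith [Real.sqrt_nonneg (((l + x) / 2) ^ 2 - y ^ 2)]
    · rintro ⟨-, h1, -⟩
      linarith
  · have hxw : 0 < x + w := by linarith
    have hdiv : w + y ^ 2 / (x + w) ≤ l ↔ y ^ 2 ≤ (l - w) * (x + w) := by
      rw [← le_sub_iff_add_le', div_le_iff₀ hxw]
    rw [max_le_iff, hdiv]
    constructor
    · rintro ⟨hx, hl⟩
      have hlw : 0 ≤ l - w := by
        by_contra! hneg
        nlinarith [mul_pos_of_neg_of_neg hneg (neg_neg_of_pos hxw), sq_nonneg y]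
      refine ⟨abs_le.2 ⟨by linarith, hx⟩, ?_, ?_⟩
      -- AM-GM: the factors `l - w` and `x + w` have sum `l + x`.
      · nlinarith [sq_nonneg (l - w - (x + w))]
      · rw [← sub_le_iff_le_add']
        apply Real.le_sqrt_of_sq_le
        nlinarith
    · rintro ⟨hx, h1, h2⟩
      refine ⟨(abs_le.1 hx).2, ?_⟩
      have hl := abs_le.1 hx
      rcases le_total w ((l - x) / 2) with hc | hc
      · nlinarith [mul_nonneg (sub_nonneg.2 hc) hxw.le, mul_self_le_mul_self hy h1]
      · have hs := Real.sq_sqrt (show 0 ≤ ((l + x) / 2) ^ 2 - y ^ 2 by nlinarith)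
        nlinarith [mul_self_le_mul_self (sub_nonneg.2 hc)
          (show w - (l - x) / 2 ≤ √(((l + x) / 2) ^ 2 - y ^ 2) by linarith)]

/-- For `y ≥ 0` it is best to take `y₂ = 0` and `y₁ = y`: the opposite half-disc then contributes up
to `b` to `|z|`, and the chord of the other at height `y` up to `√(a² - y²)`. -/
lemma mem_smul_body_iff_upperNorm_le {l : ℝ} (hl : 0 < l) {p : EuclideanSpace ℝ (Fin 3)}
    (hp : 0 ≤ p 1) : p ∈ l • body ↔ upperNorm (p 0) (p 1) |p 2| ≤ l := by
  rw [mem_smul_body_iff hl, upperNorm_le_iff hp (abs_nonneg _)]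
  constructor
  · rintro ⟨a, b, y₁, z₁, y₂, z₂, ha, hb, hab, h0, hy₁, h₁, hy₂, h₂, hp1, hp2⟩
    have ea : (l + p 0) / 2 = a := by linarith
    have eb : (l - p 0) / 2 = b := by linarith
    have hy : y₁ ≤ a := by nlinarith [sq_nonneg z₁]
    rw [ea, eb]
    refine ⟨abs_le.2 ⟨by linarith, by linarith⟩, by linarith, ?_⟩
    have hz₂ : |z₂| ≤ b := abs_le_of_sq_le_sq (by nlinarith [sq_nonneg y₂]) hb
    have hz₁ : |z₁| ≤ √(a ^ 2 - p 1 ^ 2) := by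
      apply Real.le_sqrt_of_sq_le
      rw [sq_abs]
      nlinarith
    rw [hp2]
    linarith [abs_add_le z₁ z₂]
  · rintro ⟨hx, h1, h2⟩
    have hx' := abs_le.1 hx
    set a := (l + p 0) / 2
    set b := (l - p 0) / 2
    have hab : a + b = l := by simp only [a, b]; ring
    have hab' : a - b = p 0 := by simp only [a, b]; ring
    have hs := Real.sq_sqrt (show 0 ≤ a ^ 2 - p 1 ^ 2 by nlinarith)
    have hb : 0 ≤ b := by linarith
    set r := √(a ^ 2 - p 1 ^ 2)
    have hr : 0 ≤ r := Real.sqrt_nonneg _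
    have h2' := abs_le.1 h2
    -- The first half-disc takes `z` clamped to its chord `[-r, r]`; the remainder has absolute
    -- value at most `b`.
    refine ⟨a, b, p 1, max (-r) (min r (p 2)), 0, p 2 - max (-r) (min r (p 2)), by linarith, hb,
      hab, hab', hp, ?_, le_rfl, ?_, by ring, by ring⟩
    · have : max (-r) (min r (p 2)) ^ 2 ≤ r ^ 2 :=
        sq_le_sq' (le_max_left _ _) (max_le (by linarith) (min_le_left _ _))
      linarith
    · have : (p 2 - max (-r) (min r (p 2))) ^ 2 ≤ b ^ 2 := by
        apply sq_le_sq'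
        · rcases max_cases (-r) (min r (p 2)) with h | h <;>
          rcases min_cases r (p 2) with h' | h' <;> linarith
        · rcases max_cases (-r) (min r (p 2)) with h | h <;>
          rcases min_cases r (p 2) with h' | h' <;> linarith
      linarith

lemma gauge_body_of_nonneg {p : EuclideanSpace ℝ (Fin 3)} (hp : 0 ≤ p 1) :
    gauge body p = upperNorm (p 0) (p 1) |p 2| := by
  have h0 := upperNorm_nonneg (x := p 0) hp (abs_nonneg (p 2))
  apply le_antisymm
  · refine le_of_forall_pos_le_add fun ε hε => ?_
    have : 0 < upperNorm (p 0) (p 1) |p 2| + ε := by linarith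
    exact gauge_le_of_mem this.le ((mem_smul_body_iff_upperNorm_le this hp).2 (by linarith))
  · rw [gauge_def]
    refine le_csInf ⟨upperNorm (p 0) (p 1) |p 2| + 1, ?_, ?_⟩ fun l hl =>
      (mem_smul_body_iff_upperNorm_le hl.1 hp).1 hl.2
    · exact mem_Ioi.2 (by linarith)
    · exact (mem_smul_body_iff_upperNorm_le (by linarith) hp).2 (by linarith)

/-! ### The body as a symmetric convex body -/

lemma neg_mem_body {p : EuclideanSpace ℝ (Fin 3)} (hp : p ∈ body) : -p ∈ body := by
  have h : p ∈ (1 : ℝ) • body := by simpa using hp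
  obtain ⟨a, b, y₁, z₁, y₂, z₂, ha, hb, hab, h0, hy₁, h₁, hy₂, h₂, hp1, hp2⟩ :=
    (mem_smul_body_iff one_pos).1 h
  have : -p ∈ (1 : ℝ) • body := (mem_smul_body_iff one_pos).2
    ⟨b, a, y₂, -z₂, y₁, -z₁, hb, ha, by linarith, by simp [← h0], hy₂, by simpa using h₂, hy₁,
      by simpa using h₁, by simp [hp1], by rw [PiLp.neg_apply, hp2]; ring⟩
  simpa using this

lemma gauge_body_neg (p : EuclideanSpace ℝ (Fin 3)) : gauge body (-p) = gauge body p :=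
  gauge_neg (fun _ => neg_mem_body) p

lemma convex_body : Convex ℝ body := convex_convexHull ℝ _

lemma isCompact_convexJoin {E : Type*} [NormedAddCommGroup E] [NormedSpace ℝ E] {s t : Set E}
    (hs : IsCompact s) (ht : IsCompact t) : IsCompact (convexJoin ℝ s t) := by
  have : convexJoin ℝ s t =
      (fun q : ℝ × E × E => AffineMap.lineMap q.2.1 q.2.2 q.1) '' (Icc (0 : ℝ) 1 ×ˢ s ×ˢ t) := by
    ext p
    simp only [mem_convexJoin, segment_eq_image_lineMap, mem_image, Prod.exists, mem_prod]
    grind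
  rw [this]
  refine (isCompact_Icc.prod (hs.prod ht)).image ?_
  simp only [AffineMap.lineMap_apply_module]
  fun_prop

lemma isBounded_of_halfDisc {c : ℝ} {s : Set (EuclideanSpace ℝ (Fin 3))}
    (hs : ∀ p ∈ s, p 0 = c ∧ p 1 ^ 2 + p 2 ^ 2 ≤ 1) : Bornology.IsBounded s := by
  refine isBounded_iff_forall_norm_le.2 ⟨√(c ^ 2 + 1), fun p hp => ?_⟩
  obtain ⟨h0, h2⟩ := hs p hp
  rw [EuclideanSpace.norm_eq, Fin.sum_univ_three]
  apply Real.sqrt_le_sqrt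
  simp only [Real.norm_eq_abs, sq_abs, h0]
  linarith

lemma isCompact_body : IsCompact body := by
  rw [body_eq_convexJoin, convexHull_halfCircle, convexHull_oppositeHalfCircle]
  refine isCompact_convexJoin (isCompact_of_isClosed_isBounded ?_
    (isBounded_of_halfDisc fun p hp => ⟨hp.1, hp.2.2⟩)) (isCompact_of_isClosed_isBounded ?_
    (isBounded_of_halfDisc fun p hp => ⟨hp.1, hp.2.2⟩))
  all_goals
    simp only [ofPred_and]
    refine (isClosed_eq ?_ ?_).inter ((isClosed_le ?_ ?_).inter (isClosed_le ?_ ?_)) <;> fun_prop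

lemma body_mem_nhds_zero : body ∈ 𝓝 (0 : EuclideanSpace ℝ (Fin 3)) := by
  have key : ∀ p : EuclideanSpace ℝ (Fin 3), ‖p‖ < 1 / 4 → 0 ≤ p 1 → p ∈ body := by
    intro p hp h1
    have h : ∀ i, |p i| ≤ 1 / 4 := fun i => by
      simpa using (PiLp.norm_apply_le p i).trans hp.le
    have : p ∈ (1 : ℝ) • body := by
      rw [mem_smul_body_iff_upperNorm_le one_pos h1, upperNorm_le_iff h1 (abs_nonneg _)]
      have e0 := abs_le.1 (h 0)
      have e1 := abs_le.1 (h 1)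
      have e2 := h 2
      refine ⟨by linarith [h 0], by linarith, ?_⟩
      linarith [Real.sqrt_nonneg (((1 + p 0) / 2) ^ 2 - p 1 ^ 2)]
    simpa using this
  filter_upwards [ball_mem_nhds (0 : EuclideanSpace ℝ (Fin 3)) (show (0 : ℝ) < 1 / 4 by norm_num)]
    with p hp
  rw [mem_ball_zero_iff] at hp
  rcases le_total 0 (p 1) with h | h
  · exact key p hp h
  · simpa using neg_mem_body (key (-p) (by simpa using hp) (by simpa using h))

lemma interior_body_nonempty : (interior body).Nonempty :=
  ⟨0, mem_interior_iff_mem_nhds.2 body_mem_nhds_zero⟩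

lemma continuous_gauge_body : Continuous (gauge body) :=
  continuous_gauge convex_body body_mem_nhds_zero

/-! ### Equidistance in the half-space `y ≥ 0` -/

lemma upperNorm_zero {x w : ℝ} (hw : 0 ≤ w) : upperNorm x 0 w = max |x| w := by
  unfold upperNorm
  split_ifs with h
  · rw [abs_of_nonpos (by linarith), max_eq_left (by linarith)]; ring
  · rcases le_total 0 x with hx | hx
    · simp [abs_of_nonneg hx]
    · rw [abs_of_nonpos hx, max_eq_right (by linarith : -x ≤ w)]
      simp only [ne_eq, OfNat.ofNat_ne_zero, not_false_eq_true, zero_pow, zero_div, add_zero]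
      exact max_eq_right (by linarith)

lemma gauge_body_of_eq_zero {p : EuclideanSpace ℝ (Fin 3)} (hp : p 1 = 0) :
    gauge body p = max |p 0| |p 2| := by
  rw [gauge_body_of_nonneg hp.ge, hp, upperNorm_zero (abs_nonneg _)]

lemma direction_mem_unitSphere : direction ∈ unitSphere body := by
  change gauge body direction = 1
  rw [gauge_body_of_eq_zero (by simp [direction])]
  simp [direction]

/-- Over the half-disc in the plane `x = 1`, a face of the body, the norm is the linear functional
`x`. -/
lemma upperNorm_of_cone {x y w : ℝ} (hy : 0 ≤ y) (hw : 0 ≤ w) (hx : 0 ≤ x)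
    (h : y ^ 2 + w ^ 2 ≤ x ^ 2) : upperNorm x y w = x := by
  have hyx : y ≤ x := by nlinarith
  unfold upperNorm
  split_ifs with h'
  · linarith
  · rw [max_eq_left]
    rw [← le_sub_iff_add_le', div_le_iff₀ (by linarith)]
    nlinarith

lemma upperNorm_of_not_cone {x y w : ℝ} (hy : 0 ≤ y) (h : y < x + w)
    (hx : x < 0 ∨ x ^ 2 < y ^ 2 + w ^ 2) (hw : 0 ≤ w) :
    upperNorm x y w = w + y ^ 2 / (x + w) := by
  unfold upperNorm
  rw [if_neg h.not_ge, max_eq_right]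
  rw [← sub_le_iff_le_add', le_div_iff₀ (by linarith)]
  rcases hx with hx | hx <;> nlinarith

/-- Outside the cone over that face both `2y - x` and `w + y² / (x + w)` decrease strictly in `x`.
Positivity of `y` is essential: in the plane `y = 0` the norm `max |x| w` has constant stretches,
which produce the flat wedges of the bisector. -/
lemma upperNorm_lt_upperNorm {x₁ x₂ y w : ℝ} (hy : 0 < y) (hw : 0 ≤ w) (hlt : x₁ < x₂)
    (hx : x₂ < 0 ∨ x₂ ^ 2 < y ^ 2 + w ^ 2) : upperNorm x₂ y w < upperNorm x₁ y w := by
  rcases le_or_gt (x₂ + w) y with h₂ | h₂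
  · unfold upperNorm
    rw [if_pos h₂, if_pos (by linarith)]
    linarith
  · rw [upperNorm_of_not_cone hy.le h₂ hx hw]
    have hpos : 0 < x₂ + w := by linarith
    unfold upperNorm
    split_ifs with h₁
    · have : y ^ 2 / (x₂ + w) < y := by
        rw [div_lt_iff₀ hpos]; nlinarith
      linarith
    · refine lt_of_lt_of_le ?_ (le_max_right _ _)
      have : y ^ 2 / (x₂ + w) < y ^ 2 / (x₁ + w) :=
        div_lt_div_of_pos_left (by positivity) (by linarith) (by linarith)
      linarith

/-- By strict monotonicity the point shifted to `x + 1` must lie in the cone, so the common distance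
is `x + 1`. Equating it with the two branches at `x - 1` gives `x = y` and `y² = (x + 1 - w) * (x -
1 + w) = x² - (w - 1)²`. -/
lemma upperNorm_add_one_eq_iff {x y w : ℝ} (hy : 0 < y) (hw : 0 ≤ w) :
    upperNorm (x + 1) y w = upperNorm (x - 1) y w ↔
      0 < x ∧ x ^ 2 = y ^ 2 + (max (w - 1) 0) ^ 2 := by
  by_cases hc : 0 ≤ x + 1 ∧ y ^ 2 + w ^ 2 ≤ (x + 1) ^ 2
  · rw [upperNorm_of_cone hy.le hw hc.1 hc.2]
    by_cases hd : 0 ≤ x - 1 ∧ y ^ 2 + w ^ 2 ≤ (x - 1) ^ 2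
    · rw [upperNorm_of_cone hy.le hw hd.1 hd.2]
      refine ⟨fun h => by linarith, fun ⟨h, h'⟩ => ?_⟩
      exfalso
      rcases max_cases (w - 1) 0 with ⟨e, h0⟩ | ⟨e, h0⟩ <;> rw [e] at h' <;> nlinarith
    · have hd' : x - 1 < 0 ∨ (x - 1) ^ 2 < y ^ 2 + w ^ 2 := by
        by_contra! h; exact hd h
      rcases le_or_gt (x - 1 + w) y with h₁ | h₁
      · have : upperNorm (x - 1) y w = 2 * y - (x - 1) := if_pos h₁
        rw [this]
        constructor
        · intro h
          obtain rfl : x = y := by linarith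
          refine ⟨hy, ?_⟩
          rw [max_eq_right (by linarith)]; ring
        · rintro ⟨h, h'⟩
          rcases max_cases (w - 1) 0 with ⟨e, h0⟩ | ⟨e, h0⟩ <;> rw [e] at h' <;> nlinarith
      · have hpos : 0 < x - 1 + w := by linarith
        rw [upperNorm_of_not_cone hy.le h₁ hd' hw, ← sub_eq_iff_eq_add', eq_div_iff hpos.ne']
        constructor
        · intro h
          have hx : 0 < x := by
            by_contra! hx
            nlinarith
          have hxw : (w - 1) ^ 2 + y ^ 2 = x ^ 2 := by nlinarith
          refine ⟨hx, ?_⟩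
          rcases max_cases (w - 1) 0 with ⟨e, h0⟩ | ⟨e, h0⟩ <;> rw [e]
          · linarith
          · nlinarith
        · rintro ⟨h, h'⟩
          rcases max_cases (w - 1) 0 with ⟨e, h0⟩ | ⟨e, h0⟩ <;> rw [e] at h' <;> nlinarith
  · have hc' : x + 1 < 0 ∨ (x + 1) ^ 2 < y ^ 2 + w ^ 2 := by
      by_contra! h; exact hc h
    refine ⟨fun h => absurd h (upperNorm_lt_upperNorm hy hw (by linarith) hc').ne, ?_⟩
    rintro ⟨h, h'⟩
    exfalso
    refine hc ⟨by linarith, ?_⟩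
    rcases max_cases (w - 1) 0 with ⟨e, h0⟩ | ⟨e, h0⟩ <;> rw [e] at h' <;> nlinarith

/-! ### The homogenized equation of the bisector and its ideal points -/

/-- For each `m ≥ 0`, the function `x ↦ fold x m` vanishes for `|x| ≤ m` and has the branches
`√(x² - m²)` and `-√(x² - m²)` for `x ≥ m` and `x ≤ -m`. -/
noncomputable def fold (x m : ℝ) : ℝ := √(max x 0 ^ 2 - m ^ 2) - √(max (-x) 0 ^ 2 - m ^ 2)

lemma continuous_fold : Continuous fun q : ℝ × ℝ => fold q.1 q.2 := by
  unfold fold; fun_prop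

lemma fold_of_nonneg {x : ℝ} (hx : 0 ≤ x) (m : ℝ) : fold x m = √(x ^ 2 - m ^ 2) := by
  have : √(-m ^ 2) = 0 := Real.sqrt_eq_zero_of_nonpos (by nlinarith)
  simp [fold, max_eq_left hx, max_eq_right (neg_nonpos.2 hx), this]

lemma fold_neg (x m : ℝ) : fold (-x) m = -fold x m := by
  simp [fold]

lemma fold_mul {c : ℝ} (hc : 0 ≤ c) (x m : ℝ) : fold (c * x) (c * m) = c * fold x m := by
  have h : ∀ x, √(max (c * x) 0 ^ 2 - (c * m) ^ 2) = c * √(max x 0 ^ 2 - m ^ 2) := fun x => by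
    have : max (c * x) 0 = c * max x 0 := by rw [mul_max_of_nonneg _ _ hc, mul_zero]
    rw [this, mul_pow, mul_pow, ← mul_sub, Real.sqrt_mul (sq_nonneg c), Real.sqrt_sq hc]
  simp only [fold, ← mul_neg, h, mul_sub]

lemma fold_nonneg {x : ℝ} (hx : 0 ≤ x) (m : ℝ) : 0 ≤ fold x m := by
  rw [fold_of_nonneg hx]; exact Real.sqrt_nonneg _

lemma fold_nonpos {x : ℝ} (hx : x ≤ 0) (m : ℝ) : fold x m ≤ 0 := by
  rw [← neg_neg x, fold_neg]
  exact neg_nonpos.2 (fold_nonneg (neg_nonneg.2 hx) m)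

lemma eq_fold_iff_of_pos {x y m : ℝ} (hy : 0 < y) :
    y = fold x m ↔ 0 < x ∧ x ^ 2 = y ^ 2 + m ^ 2 := by
  rcases le_or_gt x 0 with hx | hx
  · exact ⟨fun h => by linarith [fold_nonpos hx m], fun h => by linarith [h.1]⟩
  · rw [fold_of_nonneg hx.le, eq_comm, Real.sqrt_eq_iff_mul_self_eq_of_pos hy]
    constructor
    · intro h; exact ⟨hx, by linarith⟩
    · rintro ⟨-, h⟩; linarith

lemma fold_eq_zero_iff {x m : ℝ} (hm : 0 ≤ m) : fold x m = 0 ↔ |x| ≤ m := by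
  have key : ∀ x : ℝ, 0 ≤ x → (fold x m = 0 ↔ |x| ≤ m) := fun x hx => by
    rw [fold_of_nonneg hx, Real.sqrt_eq_zero', sub_nonpos, abs_of_nonneg hx]
    exact pow_le_pow_iff_left₀ hx hm two_ne_zero
  rcases le_total 0 x with hx | hx
  · exact key x hx
  · have := key (-x) (by linarith)
    rwa [fold_neg, neg_eq_zero, abs_neg] at this

/-- The homogenized equation of the bisector: the bisector is given by `r = 1`, its ideal points
by `r = 0`. -/
def OnCone (r : ℝ) (p : EuclideanSpace ℝ (Fin 3)) : Prop :=
  p 1 = fold (p 0) (max (|p 2| - r) 0)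

lemma onCone_neg_iff {r : ℝ} {p : EuclideanSpace ℝ (Fin 3)} : OnCone r (-p) ↔ OnCone r p := by
  simp [OnCone, fold_neg]

lemma onCone_smul_iff {r c : ℝ} (hc : 0 < c) {p : EuclideanSpace ℝ (Fin 3)} :
    OnCone (c * r) (c • p) ↔ OnCone r p := by
  have : max (|c * p 2| - c * r) 0 = c * max (|p 2| - r) 0 := by
    rw [mul_max_of_nonneg _ _ hc.le, mul_zero, abs_mul, abs_of_pos hc, mul_sub]
  simp only [OnCone, PiLp.smul_apply, smul_eq_mul, this, fold_mul hc.le]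
  exact mul_right_inj' hc.ne'

lemma neg_mem_bisector_iff {p : EuclideanSpace ℝ (Fin 3)} :
    -p ∈ bisector body direction ↔ p ∈ bisector body direction := by
  change gauge body (-p + direction) = gauge body (-p - direction) ↔ _ = _
  rw [← gauge_body_neg, ← gauge_body_neg (-p - direction)]
  simp only [neg_add_rev, neg_sub, sub_neg_eq_add, neg_neg]
  rw [add_comm (-direction), ← sub_eq_add_neg, add_comm direction, eq_comm]

lemma max_abs_add_one_eq_iff {x w : ℝ} (hw : 0 ≤ w) :
    max |x + 1| w = max |x - 1| w ↔ |x| ≤ max (w - 1) 0 := by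
  rcases abs_cases (x + 1) with h1 | h1 <;> rcases abs_cases (x - 1) with h2 | h2 <;>
  rcases abs_cases x with h3 | h3 <;> grind

lemma max_abs_add_one_of_le {x w : ℝ} (h : |x| ≤ max (w - 1) 0) :
    max |x + 1| w = max (|x| + 1) w := by
  rcases abs_cases (x + 1) with h1 | h1 <;> rcases abs_cases x with h2 | h2 <;> grind

lemma gauge_body_sub_direction_of_nonneg {p : EuclideanSpace ℝ (Fin 3)} (hp : 0 ≤ p 1) :
    gauge body (p - direction) = upperNorm (p 0 - 1) (p 1) |p 2| := by
  rw [gauge_body_of_nonneg] <;> simp [direction, hp]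

lemma gauge_body_add_direction_of_nonneg {p : EuclideanSpace ℝ (Fin 3)} (hp : 0 ≤ p 1) :
    gauge body (p + direction) = upperNorm (p 0 + 1) (p 1) |p 2| := by
  rw [gauge_body_of_nonneg] <;> simp [direction, hp]

lemma mem_bisector_iff {p : EuclideanSpace ℝ (Fin 3)} :
    p ∈ bisector body direction ↔ OnCone 1 p := by
  have key : ∀ p : EuclideanSpace ℝ (Fin 3), 0 ≤ p 1 →
      (p ∈ bisector body direction ↔ OnCone 1 p) := by
    intro p hp
    change gauge body (p + direction) = gauge body (p - direction) ↔ _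
    rw [gauge_body_add_direction_of_nonneg hp, gauge_body_sub_direction_of_nonneg hp, OnCone]
    rcases hp.eq_or_lt with h0 | h0
    · rw [← h0, upperNorm_zero (abs_nonneg _), upperNorm_zero (abs_nonneg _),
        max_abs_add_one_eq_iff (abs_nonneg _), eq_comm (a := (0 : ℝ)),
        fold_eq_zero_iff (le_max_right _ _)]
    · rw [upperNorm_add_one_eq_iff h0 (abs_nonneg _), eq_fold_iff_of_pos h0]
  rcases le_total 0 (p 1) with hp | hp
  · exact key p hp
  · rw [← neg_mem_bisector_iff, ← onCone_neg_iff]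
    exact key (-p) (by simpa using hp)

/-- The common distance of a point of the bisector from `direction` and `-direction`. -/
lemma gauge_body_sub_direction {p : EuclideanSpace ℝ (Fin 3)} (hp : OnCone 1 p) :
    gauge body (p - direction) = max (|p 0| + 1) |p 2| := by
  have key : ∀ p : EuclideanSpace ℝ (Fin 3), 0 ≤ p 1 → OnCone 1 p →
      gauge body (p - direction) = max (|p 0| + 1) |p 2| := by
    intro p hp h
    have hb : gauge body (p + direction) = gauge body (p - direction) := mem_bisector_iff.2 h
    rw [← hb, gauge_body_add_direction_of_nonneg hp]
    unfold OnCone at h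
    rcases hp.eq_or_lt with h0 | h0
    · rw [← h0, eq_comm, fold_eq_zero_iff (le_max_right _ _)] at h
      rw [← h0, upperNorm_zero (abs_nonneg _)]
      exact max_abs_add_one_of_le h
    · obtain ⟨hx, h'⟩ := (eq_fold_iff_of_pos h0).1 h
      have hm : |p 2| - 1 ≤ p 0 := by
        have := le_max_left (|p 2| - 1) 0
        have := le_max_right (|p 2| - 1) 0
        nlinarith
      -- `p + direction` lies in the cone where the norm is the first coordinate.
      rw [abs_of_pos hx, max_eq_left (by linarith),
        upperNorm_of_cone hp (abs_nonneg _) (by linarith)]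
      have := abs_nonneg (p 2)
      rcases max_cases (|p 2| - 1) 0 with ⟨e, h0⟩ | ⟨e, h0⟩ <;> rw [e] at h' <;> nlinarith
  rcases le_total 0 (p 1) with hp' | hp'
  · exact key p hp' hp
  · have hb : gauge body (p + direction) = gauge body (p - direction) := mem_bisector_iff.2 hp
    have := key (-p) (by simpa using hp') (onCone_neg_iff.2 hp)
    rw [← gauge_body_neg] at this
    simpa [hb, add_comm] using this

lemma gauge_body_of_onCone_zero {p : EuclideanSpace ℝ (Fin 3)} (hp : OnCone 0 p) :
    gauge body p = max |p 0| |p 2| := by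
  have key : ∀ p : EuclideanSpace ℝ (Fin 3), 0 ≤ p 1 → OnCone 0 p →
      gauge body p = max |p 0| |p 2| := by
    intro p hp h
    unfold OnCone at h
    rcases hp.eq_or_lt with h0 | h0
    · exact gauge_body_of_eq_zero h0.symm
    · obtain ⟨hx, h'⟩ := (eq_fold_iff_of_pos h0).1 h
      rw [sub_zero, max_eq_left (abs_nonneg _)] at h'
      rw [gauge_body_of_nonneg hp, upperNorm_of_cone hp (abs_nonneg _) hx.le h'.ge,
        abs_of_pos hx, max_eq_left]
      have := abs_nonneg (p 2)
      nlinarith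
  rcases le_total 0 (p 1) with hp' | hp'
  · exact key p hp' hp
  · simpa [gauge_body_neg] using key (-p) (by simpa using hp') (onCone_neg_iff.2 hp)

lemma tendsto_fold {α : Type*} {l : Filter α} {x m : α → ℝ} {x₀ m₀ : ℝ}
    (hx : Tendsto x l (𝓝 x₀)) (hm : Tendsto m l (𝓝 m₀)) :
    Tendsto (fun i => fold (x i) (m i)) l (𝓝 (fold x₀ m₀)) := by
  have h := hx.prodMk_nhds hm
  have h' := continuous_fold.tendsto (x₀, m₀)
  have h'' := h'.comp h
  exact h''

lemma tendsto_onCone_rhs {α : Type*} {l : Filter α} {r : α → ℝ} {p : α → EuclideanSpace ℝ (Fin 3)}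
    {r₀ : ℝ} {p₀ : EuclideanSpace ℝ (Fin 3)} (hr : Tendsto r l (𝓝 r₀)) (hp : Tendsto p l (𝓝 p₀)) :
    Tendsto (fun i => fold (p i 0) (max (|p i 2| - r i) 0)) l
      (𝓝 (fold (p₀ 0) (max (|p₀ 2| - r₀) 0))) := by
  have h : ∀ j : Fin 3, Tendsto (fun i => p i j) l (𝓝 (p₀ j)) := fun j =>
    ((EuclideanSpace.proj (𝕜 := ℝ) j).continuous.tendsto p₀).comp hp
  have h0 := h 0
  have h2 : Tendsto (fun i => max (|p i 2| - r i) 0) l (𝓝 (max (|p₀ 2| - r₀) 0)) :=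
    ((h 2).abs.sub hr).max (tendsto_const_nhds (x := (0 : ℝ)))
  exact tendsto_fold h0 h2

lemma smul_mem_bisector_iff {t : ℝ} (ht : 0 < t) {p : EuclideanSpace ℝ (Fin 3)} :
    t • p ∈ bisector body direction ↔ OnCone t⁻¹ p := by
  rw [mem_bisector_iff, ← onCone_smul_iff (r := t⁻¹) ht, mul_inv_cancel₀ ht.ne']

/-- Dividing a bisector point `t • v` by `t` turns `r = 1` into `r = 1 / t`, which tends to `0`;
continuity of `fold` carries the equation to the limit. -/
lemma mem_idealPoints_iff {u : EuclideanSpace ℝ (Fin 3)} :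
    u ∈ idealPoints body direction ↔ ‖u‖ = 1 ∧ OnCone 0 u := by
  refine and_congr_right fun _ => ⟨?_, fun h => ?_⟩
  · rintro ⟨t, v, htv, ht, hv⟩
    have h1 : Tendsto (fun i => v i 1) atTop (𝓝 (u 1)) :=
      ((EuclideanSpace.proj (𝕜 := ℝ) (1 : Fin 3)).continuous.tendsto u).comp hv
    refine tendsto_nhds_unique_of_eventuallyEq h1
      (tendsto_onCone_rhs (tendsto_inv_atTop_zero.comp ht) hv) ?_
    filter_upwards [ht.eventually_gt_atTop 0] with i hi
    exact (smul_mem_bisector_iff hi).1 (htv i)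
  · have ht : Tendsto (fun i : ℕ => (i : ℝ) + 1) atTop atTop :=
      tendsto_atTop_add_const_right _ _ tendsto_natCast_atTop_atTop
    -- Keep the `x` and `z` of `u` and recompute `y` from the equation with `r = 1 / (i + 1)`.
    refine ⟨fun i => i + 1,
      fun i => !₂[u 0, fold (u 0) (max (|u 2| - ((i : ℝ) + 1)⁻¹) 0), u 2], fun i => ?_, ht, ?_⟩
    · rw [smul_mem_bisector_iff (by positivity)]
      simp [OnCone]
    · have h1 := tendsto_onCone_rhs (tendsto_inv_atTop_zero.comp ht) (tendsto_const_nhds (x := u))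
      have hc : Continuous fun y : ℝ => (!₂[u 0, y, u 2] : EuclideanSpace ℝ (Fin 3)) := by
        fun_prop
      have hu : u = !₂[u 0, fold (u 0) (max (|u 2| - 0) 0), u 2] := by
        ext j
        fin_cases j
        · rfl
        · exact h
        · rfl
      conv => rhs; rw [hu]
      exact (hc.tendsto _).comp h1

/-! ### Topological obstructions to being a manifold -/

section Topology

/-- Two points are joined by their segment or, if it meets `x`, by a detour through a point of `C`
off their line. Such a point exists because `C` has interior and the dimension exceeds one. -/
lemma isPreconnected_convex_diff_singleton {E : Type*} [NormedAddCommGroup E] [NormedSpace ℝ E]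
    (hE : 1 < Module.rank ℝ E) {C : Set E} (hC : Convex ℝ C) (hne : (interior C).Nonempty) (x : E) :
    IsPreconnected (C \ {x}) := by
  refine isPreconnected_of_forall_pair fun a ha b hb => ?_
  by_cases hx : x ∈ segment ℝ a b
  · obtain ⟨z, hzC, hz⟩ : ∃ z ∈ C, ∀ r : ℝ, z ≠ a + r • (b - a) := by
      obtain ⟨v, hv⟩ : ∃ v : E, ∀ r : ℝ, r • (b - a) ≠ v := by
        have := hE.not_ge
        rw [rank_le_one_iff] at this
        push Not at this
        exact this (b - a)
      obtain ⟨c, hc⟩ := hne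
      by_cases h : ∀ r : ℝ, c ≠ a + r • (b - a)
      · exact ⟨c, interior_subset hc, h⟩
      · push Not at h
        obtain ⟨s, hs⟩ := h
        have ht : ∀ᶠ t in 𝓝[≠] (0 : ℝ), c + t • v ∈ C := by
          apply nhdsWithin_le_nhds
          have hcont : Continuous fun t : ℝ => c + t • v := by fun_prop
          refine hcont.continuousAt.eventually ?_
          simpa using mem_interior_iff_mem_nhds.1 hc
        obtain ⟨t, htC, ht0⟩ := (ht.and self_mem_nhdsWithin).exists
        refine ⟨c + t • v, htC, fun r hr => hv (t⁻¹ * (r - s)) ?_⟩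
        have : t • v = (r - s) • (b - a) := by
          rw [hs] at hr
          rw [sub_smul]
          rw [eq_sub_iff_add_eq, add_comm]
          exact add_left_cancel (add_assoc a _ _ ▸ hr)
        rw [mul_smul, ← this, smul_smul, inv_mul_cancel₀ ht0, one_smul]
    rw [segment_eq_image'] at hx
    obtain ⟨s, -, hs⟩ := hx
    have hs' : x = a + s • (b - a) := hs.symm
    refine ⟨segment ℝ a z ∪ segment ℝ z b, ?_, Or.inl (left_mem_segment ℝ _ _),
      Or.inr (right_mem_segment ℝ _ _), IsPreconnected.union z (right_mem_segment ℝ _ _)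
        (left_mem_segment ℝ _ _) (convex_segment _ _).isPreconnected
        (convex_segment _ _).isPreconnected⟩
    refine subset_sdiff.2 ⟨union_subset (hC.segment_subset ha.1 hzC)
      (hC.segment_subset hzC hb.1), ?_⟩
    rw [disjoint_singleton_right]
    rintro (h | h)
    · rw [segment_eq_image'] at h
      obtain ⟨t, -, ht⟩ := h
      have ht' : x = a + t • (z - a) := ht.symm
      have ht0 : t ≠ 0 := by
        rintro rfl
        exact ha.2 (by simp [ht'])
      apply hz (t⁻¹ * s)
      have : t • (z - a) = s • (b - a) := add_left_cancel (ht'.symm.trans hs')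
      rw [mul_smul, ← this, smul_smul, inv_mul_cancel₀ ht0, one_smul, add_sub_cancel]
    · rw [segment_symm, segment_eq_image'] at h
      obtain ⟨t, -, ht⟩ := h
      have ht' : x = b + t • (z - b) := ht.symm
      have ht0 : t ≠ 0 := by
        rintro rfl
        exact hb.2 (by simp [ht'])
      apply hz (1 + t⁻¹ * (s - 1))
      have : t • (z - b) = (s - 1) • (b - a) := by
        rw [sub_smul, one_smul]
        rw [ht'] at hs'
        rw [eq_sub_of_add_eq' hs']
        abel
      rw [add_smul, mul_smul, ← this, smul_smul, inv_mul_cancel₀ ht0, one_smul, one_smul]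
      abel
  · exact ⟨segment ℝ a b, subset_sdiff.2 ⟨hC.segment_subset ha.1 hb.1,
      disjoint_singleton_right.2 hx⟩, left_mem_segment ℝ _ _, right_mem_segment ℝ _ _,
      (convex_segment _ _).isPreconnected⟩

/-- A point of a manifold with corners of dimension at least two is not a local cut point. -/
lemma false_of_local_cutPoint {E H X : Type*} [NormedAddCommGroup E] [NormedSpace ℝ E]
    [TopologicalSpace H] (I : ModelWithCorners ℝ E H) [TopologicalSpace X] [ChartedSpace H X]
    (hE : 1 < Module.rank ℝ E) {q : X} {W A B : Set X} (hW : W ∈ 𝓝 q) (hA : IsOpen A)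
    (hB : IsOpen B) (hAB : Disjoint A B) (hcover : W \ {q} ⊆ A ∪ B) (hqA : q ∈ closure A)
    (hqB : q ∈ closure B) : False := by
  have hqA' : q ∉ A := fun h => by
    obtain ⟨y, hy⟩ := mem_closure_iff.1 hqB A hA h
    exact disjoint_left.1 hAB hy.1 hy.2
  have hqB' : q ∉ B := fun h => by
    obtain ⟨y, hy⟩ := mem_closure_iff.1 hqA B hB h
    exact disjoint_left.1 hAB hy.2 hy.1
  set e := extChartAt I q
  obtain ⟨ε, hε, hsub⟩ : ∃ ε > 0, ball (e q) ε ∩ range I ⊆ e.target ∩ e.symm ⁻¹' W := by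
    refine mem_nhdsWithin_iff.1 (inter_mem (extChartAt_target_mem_nhdsWithin q) ?_)
    apply mem_nhdsWithin_of_mem_nhds
    apply (continuousAt_extChartAt_symm (I := I) q).preimage_mem_nhds
    simpa [e] using hW
  -- This set is convex with interior even when `q` is a boundary point, so removing `e q` leaves it
  -- connected.
  set C := ball (e q) ε ∩ range I
  have hCint : (interior C).Nonempty := by
    have : e q ∈ closure (interior (range I)) := by
      rw [I.convex_range.closure_interior_eq_closure_of_nonempty_interior I.nonempty_interior]
      exact subset_closure (mem_range_self _)
    obtain ⟨y, hy, hy'⟩ := mem_closure_iff.1 this (ball (e q) ε) isOpen_ball (mem_ball_self hε)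
    exact ⟨y, by rw [interior_inter, isOpen_ball.interior_eq]; exact ⟨hy, hy'⟩⟩
  have hS := (isPreconnected_convex_diff_singleton hE
    ((convex_ball (e q) ε).inter I.convex_range) hCint (e q)).image e.symm
    ((continuousOn_extChartAt_symm q).mono fun y hy => (hsub hy.1).1)
  have hmeet : ∀ D : Set X, q ∈ closure D → q ∉ D →
      (e.symm '' (C \ {e q}) ∩ D).Nonempty := by
    intro D hD hqD
    have hN : e.source ∩ e ⁻¹' ball (e q) ε ∈ 𝓝 q :=
      inter_mem (extChartAt_source_mem_nhds q)
        ((continuousAt_extChartAt q).preimage_mem_nhds (ball_mem_nhds _ hε))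
    obtain ⟨y, ⟨hy, hy'⟩, hyD⟩ := mem_closure_iff_nhds.1 hD _ hN
    refine ⟨y, ⟨e y, ⟨⟨hy', mem_range_self _⟩, fun h => hqD ?_⟩, e.left_inv hy⟩, hyD⟩
    rwa [← e.injOn hy (mem_extChartAt_source q) h]
  have hcov : e.symm '' (C \ {e q}) ⊆ A ∪ B := by
    rintro _ ⟨y, ⟨hyC, hyq⟩, rfl⟩
    refine hcover ⟨(hsub hyC).2, fun h => hyq ?_⟩
    have := e.right_inv (hsub hyC).1
    rw [mem_singleton_iff.1 h] at this
    exact this.symm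
  obtain ⟨y, -, hyA, hyB⟩ := hS A B hA hB hcov (hmeet A hqA hqA') (hmeet B hqB hqB')
  exact disjoint_left.1 hAB hyA hyB

/-- There is no continuous injection of a non-empty open subset of the plane into the line. -/
lemma not_injOn_of_continuousOn {U : Set (ℝ × ℝ)} (hU : IsOpen U) (hne : U.Nonempty)
    {f : ℝ × ℝ → ℝ} (hf : ContinuousOn f U) : ¬ InjOn f U := by
  intro hinj
  obtain ⟨c, hc⟩ := hne
  obtain ⟨ε, hε, hball⟩ := Metric.isOpen_iff.1 hU c hc
  have hrank : 1 < Module.rank ℝ (ℝ × ℝ) := by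
    apply Module.one_lt_rank_of_one_lt_finrank
    simp
  -- The disc without `m` is still connected, so `f` takes the intermediate value `f m` a second
  -- time.
  have key : ∀ a ∈ ball c ε, ∀ m ∈ ball c ε, ∀ b ∈ ball c ε, f a < f m → f m < f b → False := by
    intro a ha m hm b hb ham hmb
    have hS := isPreconnected_convex_diff_singleton hrank (convex_ball c ε)
      (by rw [isOpen_ball.interior_eq]; exact ⟨c, mem_ball_self hε⟩) m
    obtain ⟨x, hx, hxm⟩ := hS.intermediate_value₂ (a := a) (b := b) (f := f) (g := fun _ => f m)
      ⟨ha, fun h => by rw [mem_singleton_iff.1 h] at ham; exact ham.false⟩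
      ⟨hb, fun h => by rw [mem_singleton_iff.1 h] at hmb; exact hmb.false⟩
      (hf.mono (sdiff_subset.trans hball)) continuousOn_const ham.le hmb.le
    exact hx.2 (hinj (hball hx.1) (hball hm) hxm)
  have hmem : ∀ s : ℝ, |s| < ε → (c.1 + s, c.2) ∈ ball c ε := fun s hs => by
    rw [mem_ball, Prod.dist_eq]
    simp [hs]
  have h0 := hmem 0 (by simpa using hε)
  have h1 := hmem (ε / 2) (by rw [abs_of_pos (by positivity)]; linarith)
  have h2 := hmem (-(ε / 2)) (by rw [abs_neg, abs_of_pos (by positivity)]; linarith)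
  have n01 : f (c.1 + 0, c.2) ≠ f (c.1 + ε / 2, c.2) := fun h => by
    have := congrArg Prod.fst (hinj (hball h0) (hball h1) h)
    simp at this; linarith
  have n02 : f (c.1 + 0, c.2) ≠ f (c.1 + -(ε / 2), c.2) := fun h => by
    have := congrArg Prod.fst (hinj (hball h0) (hball h2) h)
    simp at this; linarith
  have n12 : f (c.1 + ε / 2, c.2) ≠ f (c.1 + -(ε / 2), c.2) := fun h => by
    have := congrArg Prod.fst (hinj (hball h1) (hball h2) h)
    simp at this; linarith
  rcases n01.lt_or_gt with a | a <;> rcases n02.lt_or_gt with b | b <;>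
  rcases n12.lt_or_gt with d | d
  · exact key _ h0 _ h1 _ h2 a d
  · exact key _ h0 _ h2 _ h1 b d
  · exact key _ h2 _ h0 _ h1 b a
  · exact key _ h2 _ h0 _ h1 b a
  · exact key _ h1 _ h0 _ h2 a b
  · exact key _ h1 _ h0 _ h2 a b
  · exact key _ h1 _ h2 _ h0 d b
  · exact key _ h2 _ h1 _ h0 d a

/-- A manifold with corners of dimension at most one does not contain a topological plane. -/
lemma not_injOn_of_chartedSpace {E H X : Type*} [NormedAddCommGroup E] [NormedSpace ℝ E]
    [TopologicalSpace H] (I : ModelWithCorners ℝ E H) [TopologicalSpace X] [ChartedSpace H X]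
    (L : E →L[ℝ] ℝ) (hL : Function.Injective L) {U : Set (ℝ × ℝ)} (hU : IsOpen U)
    (hne : U.Nonempty) {f : ℝ × ℝ → X} (hf : ContinuousOn f U) : ¬ InjOn f U := by
  intro hinj
  obtain ⟨u, hu⟩ := hne
  have hV : IsOpen (U ∩ f ⁻¹' (extChartAt I (f u)).source) :=
    hf.isOpen_inter_preimage hU (isOpen_extChartAt_source (I := I) (f u))
  refine not_injOn_of_continuousOn hV ⟨u, hu, mem_extChartAt_source (I := I) (f u)⟩
    (f := fun p => L (extChartAt I (f u) (f p))) ?_ ?_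
  · exact L.continuous.comp_continuousOn ((continuousOn_extChartAt (I := I) (f u)).comp
      (hf.mono inter_subset_left) fun p hp => hp.2)
  · intro p hp p' hp' h
    exact hinj hp.1 hp'.1 ((extChartAt I (f u)).injOn hp.2 hp'.2 (hL h))

/-- A space with a local cut point that also contains a topological plane is not a manifold. -/
lemma not_isTopManifoldOfSomeKind {X : Type*} [TopologicalSpace X] {q : X} {W A B : Set X}
    (hW : W ∈ 𝓝 q) (hA : IsOpen A) (hB : IsOpen B) (hAB : Disjoint A B)
    (hcover : W \ {q} ⊆ A ∪ B) (hqA : q ∈ closure A) (hqB : q ∈ closure B)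
    {U : Set (ℝ × ℝ)} (hU : IsOpen U) (hne : U.Nonempty) {f : ℝ × ℝ → X} (hf : ContinuousOn f U)
    (hinj : InjOn f U) : ¬ IsTopManifoldOfSomeKind X := by
  have key : ∀ (d : ℕ) (H : Type) [TopologicalSpace H]
      (I : ModelWithCorners ℝ (EuclideanSpace ℝ (Fin d)) H) [ChartedSpace H X], False := by
    intro d H _ I _
    -- The cut point excludes `d ≥ 2`, the embedded plane excludes `d ≤ 1`.
    rcases lt_or_ge 1 d with hd | hd
    · refine false_of_local_cutPoint I ?_ hW hA hB hAB hcover hqA hqB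
      apply Module.one_lt_rank_of_one_lt_finrank
      simpa using hd
    · obtain ⟨L, hL⟩ : ∃ L : EuclideanSpace ℝ (Fin d) →L[ℝ] ℝ, Function.Injective L := by
        interval_cases d
        · exact ⟨0, Function.injective_of_subsingleton _⟩
        · refine ⟨EuclideanSpace.proj 0, fun v w h => ?_⟩
          ext i
          rw [Subsingleton.elim i 0]
          exact h
      exact not_injOn_of_chartedSpace I L hL hU hne hf hinj
  rintro (⟨d, -, -, ⟨h⟩⟩ | ⟨d, hd, bd, -, -, h, -⟩)
  · exact key d _ (modelWithCornersSelf ℝ (EuclideanSpace ℝ (Fin d)))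
  · exact key d _ (modelWithCornersEuclideanHalfSpace d)

end Topology

/-! ### The closed disc as a surface with boundary -/

section Disc

/-- The numerator shows that the disc goes to the right half-plane and its circle to the boundary
line. -/
lemma re_cayley (a : ℂ) :
    ((1 + a) / (1 - a)).re = (1 - ‖a‖ ^ 2) / ‖1 - a‖ ^ 2 := by
  rw [Complex.div_re, ← add_div, ← Complex.normSq_eq_norm_sq, ← Complex.normSq_eq_norm_sq]
  congr 1
  simp [Complex.normSq_apply]
  ring

lemma add_one_ne_zero_of_re_nonneg {h : ℂ} (hh : 0 ≤ h.re) : h + 1 ≠ 0 := fun e => by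
  have := congrArg Complex.re e
  simp at this
  linarith

lemma norm_cayley_symm_le {h : ℂ} (hh : 0 ≤ h.re) : ‖(h - 1) / (h + 1)‖ ≤ 1 := by
  rw [norm_div]
  refine div_le_one_of_le₀ ?_ (norm_nonneg _)
  apply le_of_sq_le_sq _ (norm_nonneg _)
  rw [← Complex.normSq_eq_norm_sq, ← Complex.normSq_eq_norm_sq, Complex.normSq_apply,
    Complex.normSq_apply]
  simp
  nlinarith

lemma cayley_cayley_symm {h : ℂ} (hh : h + 1 ≠ 0) :
    (1 + (h - 1) / (h + 1)) / (1 - (h - 1) / (h + 1)) = h := by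
  have h1 : 1 + (h - 1) / (h + 1) = 2 * h / (h + 1) := by field_simp; ring
  have h2 : 1 - (h - 1) / (h + 1) = 2 / (h + 1) := by field_simp; ring
  rw [h1, h2]
  field_simp

lemma cayley_symm_cayley {a : ℂ} (ha : a ≠ 1) :
    ((1 + a) / (1 - a) - 1) / ((1 + a) / (1 - a) + 1) = a := by
  have h0 : 1 - a ≠ 0 := sub_ne_zero.2 ha.symm
  have h1 : (1 + a) / (1 - a) - 1 = 2 * a / (1 - a) := by field_simp; ring
  have h2 : (1 + a) / (1 - a) + 1 = 2 / (1 - a) := by field_simp; ring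
  rw [h1, h2]
  field_simp

lemma cayley_symm_ne_one {h : ℂ} (hh : h + 1 ≠ 0) : (h - 1) / (h + 1) ≠ 1 := fun e => by
  rw [div_eq_one_iff_eq hh] at e
  have := congrArg Complex.re e
  simp at this
  linarith

/-- The chart of the closed disc without the point `c⁻¹` by the half-plane `0 ≤ re`, given by the
Cayley transform. -/
noncomputable def cayleyChart (c : ℂ) (hc : ‖c‖ = 1) :
    OpenPartialHomeomorph (closedBall (0 : ℂ) 1) (EuclideanHalfSpace 2) where
  toFun w := ⟨!₂[((1 + c * w) / (1 - c * w)).re, ((1 + c * w) / (1 - c * w)).im], by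
    have hw : ‖c * w‖ ≤ 1 := by
      simpa [hc] using mem_closedBall_zero_iff.1 w.2
    change 0 ≤ ((1 + c * w) / (1 - c * w)).re
    rw [re_cayley]
    have : ‖c * w‖ ^ 2 ≤ 1 := pow_le_one₀ (norm_nonneg _) hw
    exact div_nonneg (by linarith) (sq_nonneg _)⟩
  invFun x := ⟨c⁻¹ * (((⟨x.1 0, x.1 1⟩ : ℂ) - 1) / (⟨x.1 0, x.1 1⟩ + 1)), by
    rw [mem_closedBall_zero_iff, norm_mul, norm_inv, hc, inv_one, one_mul]
    exact norm_cayley_symm_le x.2⟩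
  source := {w | c * w ≠ 1}
  target := univ
  map_source' _ _ := mem_univ _
  map_target' x _ := by
    have hc0 : c ≠ 0 := norm_ne_zero_iff.1 (by rw [hc]; exact one_ne_zero)
    change c * (c⁻¹ * _) ≠ 1
    rw [mul_inv_cancel_left₀ hc0]
    exact cayley_symm_ne_one (add_one_ne_zero_of_re_nonneg x.2)
  left_inv' w hw := by
    have hc0 : c ≠ 0 := norm_ne_zero_iff.1 (by rw [hc]; exact one_ne_zero)
    ext1
    change c⁻¹ * (((1 + c * w) / (1 - c * w) - 1) / ((1 + c * w) / (1 - c * w) + 1)) = (w : ℂ)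
    rw [cayley_symm_cayley hw, inv_mul_cancel_left₀ hc0]
  right_inv' x _ := by
    have hc0 : c ≠ 0 := norm_ne_zero_iff.1 (by rw [hc]; exact one_ne_zero)
    have h := cayley_cayley_symm (add_one_ne_zero_of_re_nonneg (h := ⟨x.1 0, x.1 1⟩) x.2)
    ext1
    ext i
    simp only [mul_inv_cancel_left₀ hc0, h]
    fin_cases i <;> rfl
  open_source := isOpen_ne_fun (by fun_prop) (by fun_prop)
  open_target := isOpen_univ
  continuousOn_toFun := by
    refine Topology.IsInducing.subtypeVal.continuousOn_iff.2 ?_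
    have h : ContinuousOn (fun w : closedBall (0 : ℂ) 1 => (1 + c * w) / (1 - c * w))
        {w | c * w ≠ 1} :=
      ContinuousOn.div (by fun_prop) (by fun_prop) fun w hw => sub_ne_zero.2 (Ne.symm hw)
    have h' : Continuous fun z : ℂ => (!₂[z.re, z.im] : EuclideanSpace ℝ (Fin 2)) := by fun_prop
    exact h'.comp_continuousOn h
  continuousOn_invFun := by
    refine Continuous.continuousOn (Continuous.subtype_mk ?_ _)
    have h : Continuous fun x : EuclideanHalfSpace 2 => (⟨x.1 0, x.1 1⟩ : ℂ) := by
      have : Continuous fun x : EuclideanHalfSpace 2 =>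
          Complex.equivRealProdCLM.symm (x.1 0, x.1 1) := by
        have hv : Continuous fun x : EuclideanHalfSpace 2 => x.1 := continuous_subtype_val
        fun_prop
      exact this
    exact continuous_const.mul (Continuous.div (h.sub continuous_const) (h.add continuous_const)
      fun x => add_one_ne_zero_of_re_nonneg x.2)

lemma cayleyChart_apply_zero {c : ℂ} {hc : ‖c‖ = 1} (w : closedBall (0 : ℂ) 1)
    (hw : c * w ≠ 1) : 0 = (cayleyChart c hc w).1 0 ↔ ‖(w : ℂ)‖ = 1 := by
  change 0 = ((1 + c * w) / (1 - c * w)).re ↔ _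
  have h0 : ‖1 - c * w‖ ^ 2 ≠ 0 := by
    have : 1 - c * (w : ℂ) ≠ 0 := sub_ne_zero.2 hw.symm
    positivity
  rw [re_cayley, eq_comm, div_eq_zero_iff, or_iff_left h0, norm_mul, hc, one_mul, sub_eq_zero,
    eq_comm, pow_eq_one_iff_of_nonneg (norm_nonneg _) two_ne_zero]

/-- A space homeomorphic to the closed disc is a surface with boundary, the boundary being the
preimage of the unit circle. -/
lemma isTopManifoldWithBoundary_of_homeomorph {M : Type*} [TopologicalSpace M]
    (h : M ≃ₜ closedBall (0 : ℂ) 1) :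
    IsTopManifoldWithBoundary 2 M {p | ‖(h p : ℂ)‖ = 1} := by
  -- A chart misses only the point `c⁻¹`, so `c = 1` and `c = -1` cover the disc.
  have hchart : ∀ p : M, ∃ c : ℂ, ∃ _ : ‖c‖ = 1, c * (h p : ℂ) ≠ 1 := fun p => by
    by_cases hp : (h p : ℂ) = 1
    · exact ⟨-1, by simp, by rw [hp]; norm_num⟩
    · exact ⟨1, by simp, by simpa using hp⟩
  choose c hc hne using hchart
  refine ⟨h.symm.t2Space, h.secondCountableTopology, ?_⟩
  let C : ChartedSpace (EuclideanHalfSpace 2) M :=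
    { atlas := range fun p => h.toOpenPartialHomeomorph.trans (cayleyChart (c p) (hc p))
      chartAt := fun p => h.toOpenPartialHomeomorph.trans (cayleyChart (c p) (hc p))
      mem_chart_source := fun p => by
        rw [OpenPartialHomeomorph.trans_source]
        exact ⟨mem_univ _, hne p⟩
      chart_mem_atlas := fun p => mem_range_self p }
  refine ⟨C, ?_⟩
  ext p
  change extChartAt (modelWithCornersEuclideanHalfSpace 2) p p ∈
    frontier (range (modelWithCornersEuclideanHalfSpace 2)) ↔ _
  rw [frontier_range_modelWithCornersEuclideanHalfSpace]
  exact cayleyChart_apply_zero (hc := hc p) (h p) (hne p)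

end Disc

/-! ### The ordinary bisector as a graph -/

lemma fold_zero (m : ℝ) : fold 0 m = 0 :=
  le_antisymm (fold_nonpos le_rfl m) (fold_nonneg le_rfl m)

/-- The graph of a continuous function over a domain of the `(x, z)`-plane is homeomorphic to
the domain. -/
noncomputable def graphHomeomorph (D : Set (EuclideanSpace ℝ (Fin 2)))
    (A : Set (EuclideanSpace ℝ (Fin 3))) (g : EuclideanSpace ℝ (Fin 2) → ℝ) (hg : Continuous g)
    (hA : ∀ p, p ∈ A ↔ !₂[p 0, p 2] ∈ D ∧ p 1 = g !₂[p 0, p 2]) : A ≃ₜ D where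
  toFun p := ⟨!₂[p.1 0, p.1 2], ((hA p).1 p.2).1⟩
  invFun q := ⟨!₂[q.1 0, g q, q.1 1], by
    have : (!₂[q.1 0, q.1 1] : EuclideanSpace ℝ (Fin 2)) = q := by
      ext i; fin_cases i <;> rfl
    rw [hA]
    simp [this]⟩
  left_inv p := by
    ext i
    have := ((hA p).1 p.2).2
    fin_cases i
    · rfl
    · exact this.symm
    · rfl
  right_inv q := by
    ext i; fin_cases i <;> rfl
  continuous_toFun := by fun_prop
  continuous_invFun := by fun_prop

lemma isTopManifold_bisector : IsTopManifold 2 (bisector body direction) := by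
  let h := (graphHomeomorph univ (bisector body direction)
    (fun q => fold (q 0) (max (|q 1| - 1) 0)) (by unfold fold; fun_prop)
    (fun p => by simp [mem_bisector_iff, OnCone])).trans (Homeomorph.Set.univ _)
  exact ⟨inferInstance, inferInstance, ⟨h.toOpenPartialHomeomorph.singletonChartedSpace rfl⟩⟩

lemma idealPoints_nonempty : (idealPoints body direction).Nonempty :=
  ⟨!₂[0, 0, 1], mem_idealPoints_iff.2 ⟨by simp [EuclideanSpace.norm_eq, Fin.sum_univ_three],
    by simp [OnCone, fold_zero]⟩⟩

lemma norm_sq_eq (p : EuclideanSpace ℝ (Fin 3)) : ‖p‖ ^ 2 = p 0 ^ 2 + p 1 ^ 2 + p 2 ^ 2 := by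
  rw [EuclideanSpace.real_norm_sq_eq, Fin.sum_univ_three]

/-! ### The closed bisector as a disc -/

section ClosedBisector

/-- The inverse of the ball embedding scales `q` by `1 / √(1 - ‖q‖²)`, so homogeneity gives `r = √(1
- ‖q‖²)`. On the sphere this is `0`, the equation of the ideal points. -/
lemma mem_closedBisector_iff {q : EuclideanSpace ℝ (Fin 3)} :
    q ∈ closedBisector body direction ↔ ‖q‖ ≤ 1 ∧ OnCone √(1 - ‖q‖ ^ 2) q := by
  have hball : q ∈ (OpenPartialHomeomorph.univUnitBall :
      OpenPartialHomeomorph (EuclideanSpace ℝ (Fin 3)) _) '' bisector body direction ↔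
      ‖q‖ < 1 ∧ OnCone √(1 - ‖q‖ ^ 2) q := by
    set U : OpenPartialHomeomorph (EuclideanSpace ℝ (Fin 3)) (EuclideanSpace ℝ (Fin 3)) :=
      OpenPartialHomeomorph.univUnitBall
    have hU : ∀ q : EuclideanSpace ℝ (Fin 3), ‖q‖ < 1 →
        (U.symm q ∈ bisector body direction ↔ OnCone √(1 - ‖q‖ ^ 2) q) := fun q hq => by
      have hpos : 0 < √(1 - ‖q‖ ^ 2) := Real.sqrt_pos.2 (by nlinarith [norm_nonneg q])
      rw [OpenPartialHomeomorph.univUnitBall_symm_apply, smul_mem_bisector_iff (inv_pos.2 hpos),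
        inv_inv]
    constructor
    · rintro ⟨p, hp, rfl⟩
      have hlt : ‖U p‖ < 1 := mem_ball_zero_iff.1 (U.map_source (mem_univ p))
      refine ⟨hlt, (hU _ hlt).1 ?_⟩
      rwa [U.left_inv (mem_univ p)]
    · rintro ⟨hlt, h⟩
      exact ⟨U.symm q, (hU q hlt).2 h, U.right_inv (mem_ball_zero_iff.2 hlt)⟩
  rw [closedBisector, mem_union, hball, mem_idealPoints_iff]
  constructor
  · rintro (⟨h, h'⟩ | ⟨h, h'⟩)
    · exact ⟨h.le, h'⟩
    · exact ⟨h.le, by simpa [h] using h'⟩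
  · rintro ⟨h, h'⟩
    rcases h.lt_or_eq with h | h
    · exact Or.inl ⟨h, h'⟩
    · exact Or.inr ⟨h, by simpa [h] using h'⟩

/-- At the poles `y = ±1` one has `x = 0`, and the equation would force `y = 0`. This permits
dividing by `√(1 - y²)`. -/
lemma sq_lt_one_of_onCone {r : ℝ} {q : EuclideanSpace ℝ (Fin 3)} (hq : ‖q‖ ≤ 1)
    (h : OnCone r q) : q 1 ^ 2 < 1 := by
  have hn : ‖q‖ ^ 2 ≤ 1 := pow_le_one₀ (norm_nonneg _) hq
  rw [norm_sq_eq] at hn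
  by_contra! hc
  have h0 : q 0 = 0 := by nlinarith [sq_nonneg (q 0), sq_nonneg (q 2)]
  unfold OnCone at h
  rw [h0, fold_zero] at h
  rw [h] at hc
  norm_num at hc

lemma normSq_div_eq {q : EuclideanSpace ℝ (Fin 3)} {s : ℝ} :
    ‖(⟨q 0 / s, q 2 / s⟩ : ℂ)‖ ^ 2 = (q 0 ^ 2 + q 2 ^ 2) / s ^ 2 := by
  rw [← Complex.normSq_eq_norm_sq, Complex.normSq_mk]
  ring

/-- The height of the closed bisector over a point of the disc, before rescaling. -/
noncomputable def discHeight (z : ℂ) : ℝ := fold z.re (max (|z.im| - √(1 - ‖z‖ ^ 2)) 0)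

lemma continuous_discHeight : Continuous discHeight := by
  unfold discHeight fold; fun_prop

/-- The closed bisector, parametrized by the closed disc. -/
noncomputable def closedBisectorHomeomorph :
    closedBisector body direction ≃ₜ closedBall (0 : ℂ) 1 where
  -- After this scaling `‖q‖ ≤ 1` reads `x² + z² ≤ 1`, and `r` becomes `√(1 - x² - z²)`. The height
  -- is thus a function of the new `x` and `z`, namely `discHeight`.
  toFun q := ⟨⟨q.1 0 / √(1 - q.1 1 ^ 2), q.1 2 / √(1 - q.1 1 ^ 2)⟩, by
    obtain ⟨hq, h⟩ := mem_closedBisector_iff.1 q.2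
    have h1 := sq_lt_one_of_onCone hq h
    have hn : ‖q.1‖ ^ 2 ≤ 1 := pow_le_one₀ (norm_nonneg _) hq
    rw [norm_sq_eq] at hn
    rw [mem_closedBall_zero_iff, ← sq_le_one_iff₀ (norm_nonneg _), normSq_div_eq,
      Real.sq_sqrt (by linarith)]
    exact div_le_one_of_le₀ (by linarith) (by linarith)⟩
  invFun z := ⟨(√(1 + discHeight z ^ 2))⁻¹ • !₂[(z : ℂ).re, discHeight z, (z : ℂ).im], by
    set y := discHeight z with hy
    have hz : ‖(z : ℂ)‖ ^ 2 ≤ 1 := pow_le_one₀ (norm_nonneg _) (mem_closedBall_zero_iff.1 z.2)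
    have hs : 0 < √(1 + y ^ 2) := Real.sqrt_pos.2 (by positivity)
    have hs2 : √(1 + y ^ 2) ^ 2 = 1 + y ^ 2 := Real.sq_sqrt (by positivity)
    have hnorm : ‖(√(1 + y ^ 2))⁻¹ • (!₂[(z : ℂ).re, y, (z : ℂ).im] :
        EuclideanSpace ℝ (Fin 3))‖ ^ 2 = (‖(z : ℂ)‖ ^ 2 + y ^ 2) / (1 + y ^ 2) := by
      rw [norm_smul, mul_pow, norm_sq_eq, norm_inv, inv_pow, Real.norm_eq_abs, sq_abs, hs2,
        ← Complex.normSq_eq_norm_sq, Complex.normSq_apply]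
      simp
      ring
    rw [mem_closedBisector_iff, ← sq_le_one_iff₀ (norm_nonneg _), hnorm]
    refine ⟨div_le_one_of_le₀ (by linarith) (by positivity), ?_⟩
    have : 1 - (‖(z : ℂ)‖ ^ 2 + y ^ 2) / (1 + y ^ 2) = (1 - ‖(z : ℂ)‖ ^ 2) / (1 + y ^ 2) := by
      field_simp
      ring
    rw [this, Real.sqrt_div (by linarith), div_eq_inv_mul, onCone_smul_iff (inv_pos.2 hs)]
    exact hy⟩
  left_inv q := by
    obtain ⟨hq, h⟩ := mem_closedBisector_iff.1 q.2
    have h1 := sq_lt_one_of_onCone hq h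
    have hs : 0 < √(1 - q.1 1 ^ 2) := Real.sqrt_pos.2 (by linarith)
    have hs2 : √(1 - q.1 1 ^ 2) ^ 2 = 1 - q.1 1 ^ 2 := Real.sq_sqrt (by linarith)
    set s := √(1 - q.1 1 ^ 2)
    have hy : discHeight ⟨q.1 0 / s, q.1 2 / s⟩ = q.1 1 / s := by
      have hR : √(1 - (q.1 0 ^ 2 + q.1 2 ^ 2) / s ^ 2) = s⁻¹ * √(1 - ‖q.1‖ ^ 2) := by
        have : 1 - (q.1 0 ^ 2 + q.1 2 ^ 2) / s ^ 2 = (s⁻¹) ^ 2 * (1 - ‖q.1‖ ^ 2) := by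
          rw [norm_sq_eq]
          field_simp
          rw [hs2]
          ring
        rw [this, Real.sqrt_mul (sq_nonneg _), Real.sqrt_sq (inv_pos.2 hs).le]
      have h' : OnCone (s⁻¹ * √(1 - ‖q.1‖ ^ 2)) (s⁻¹ • q.1) := (onCone_smul_iff (inv_pos.2 hs)).2 h
      rw [discHeight, normSq_div_eq, hR]
      simp only [div_eq_inv_mul]
      exact h'.symm
    have hc : (√(1 + (q.1 1 / s) ^ 2))⁻¹ = s := by
      have : 1 + (q.1 1 / s) ^ 2 = (s⁻¹) ^ 2 := by
        field_simp
        rw [hs2]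
        ring
      rw [this, Real.sqrt_sq (inv_pos.2 hs).le, inv_inv]
    ext1
    change (√(1 + discHeight ⟨q.1 0 / s, q.1 2 / s⟩ ^ 2))⁻¹ •
      !₂[q.1 0 / s, discHeight ⟨q.1 0 / s, q.1 2 / s⟩, q.1 2 / s] = q.1
    rw [hy, hc]
    ext i
    fin_cases i <;> simp <;> field_simp
  right_inv z := by
    set y := discHeight z with hy
    have hs : 0 < √(1 + y ^ 2) := Real.sqrt_pos.2 (by positivity)
    have hs2 : √(1 + y ^ 2) ^ 2 = 1 + y ^ 2 := Real.sq_sqrt (by positivity)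
    set s := √(1 + y ^ 2)
    have hc : √(1 - (s⁻¹ * y) ^ 2) = s⁻¹ := by
      have : 1 - (s⁻¹ * y) ^ 2 = (s⁻¹) ^ 2 := by
        field_simp
        rw [hs2]
        ring
      rw [this, Real.sqrt_sq (inv_pos.2 hs).le]
    ext1
    apply Complex.ext
    · change s⁻¹ * (z : ℂ).re / √(1 - (s⁻¹ * y) ^ 2) = (z : ℂ).re
      rw [hc]
      field_simp
    · change s⁻¹ * (z : ℂ).im / √(1 - (s⁻¹ * y) ^ 2) = (z : ℂ).im
      rw [hc]
      field_simp
  continuous_toFun := by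
    refine Continuous.subtype_mk ?_ _
    have hs : ∀ q : closedBisector body direction, √(1 - q.1 1 ^ 2) ≠ 0 := fun q => by
      obtain ⟨hq, h⟩ := mem_closedBisector_iff.1 q.2
      exact (Real.sqrt_pos.2 (by linarith [sq_lt_one_of_onCone hq h])).ne'
    have h : Continuous fun q : closedBisector body direction =>
        Complex.equivRealProdCLM.symm (q.1 0 / √(1 - q.1 1 ^ 2), q.1 2 / √(1 - q.1 1 ^ 2)) :=
      Complex.equivRealProdCLM.symm.continuous.comp
        ((Continuous.div (by fun_prop) (by fun_prop) hs).prodMk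
          (Continuous.div (by fun_prop) (by fun_prop) hs))
    exact h
  continuous_invFun := by
    refine Continuous.subtype_mk ?_ _
    have hd : Continuous fun z : closedBall (0 : ℂ) 1 => discHeight z :=
      continuous_discHeight.comp continuous_subtype_val
    have hs : Continuous fun z : closedBall (0 : ℂ) 1 => √(1 + discHeight z ^ 2) := by fun_prop
    have hv : Continuous fun z : closedBall (0 : ℂ) 1 =>
        (!₂[(z : ℂ).re, discHeight z, (z : ℂ).im] : EuclideanSpace ℝ (Fin 3)) := by fun_prop
    exact (hs.inv₀ fun z => (Real.sqrt_pos.2 (by positivity)).ne').smul hv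

lemma norm_closedBisectorHomeomorph_eq_one_iff (q : closedBisector body direction) :
    ‖(closedBisectorHomeomorph q : ℂ)‖ = 1 ↔
      (q : EuclideanSpace ℝ (Fin 3)) ∈ idealPoints body direction := by
  obtain ⟨hq, h⟩ := mem_closedBisector_iff.1 q.2
  have h1 := sq_lt_one_of_onCone hq h
  rw [← pow_eq_one_iff_of_nonneg (norm_nonneg _) two_ne_zero, mem_idealPoints_iff]
  change ‖(⟨q.1 0 / √(1 - q.1 1 ^ 2), q.1 2 / √(1 - q.1 1 ^ 2)⟩ : ℂ)‖ ^ 2 = 1 ↔ _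
  rw [normSq_div_eq, Real.sq_sqrt (by linarith), div_eq_one_iff_eq (by linarith),
    ← pow_eq_one_iff_of_nonneg (norm_nonneg _) two_ne_zero]
  constructor
  · intro e
    have : ‖q.1‖ ^ 2 = 1 := by rw [norm_sq_eq]; linarith
    exact ⟨this, by simpa [this] using h⟩
  · rintro ⟨e, -⟩
    rw [norm_sq_eq] at e
    linarith

lemma isTopManifoldWithBoundary_closedBisector :
    IsTopManifoldWithBoundary 2 (closedBisector body direction)
      {p | (p : EuclideanSpace ℝ (Fin 3)) ∈ idealPoints body direction} := by
  have := isTopManifoldWithBoundary_of_homeomorph closedBisectorHomeomorph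
  simpa only [norm_closedBisectorHomeomorph_eq_one_iff] using this

end ClosedBisector

/-! ### The bounded representation as a graph over a square -/

section BoundedRepresentation

/-- Treats ordinary points (`r = 1`) and ideal points (`r = 0`) together. If `|x| + r` attains the
maximum, the rescaled `r` is exactly `1 - |x|`. -/
lemma smul_onCone_of_pos {r T : ℝ} {p : EuclideanSpace ℝ (Fin 3)} (hp : OnCone r p)
    (hT : T = max (|p 0| + r) |p 2|) (hpos : 0 < T) (hr : 0 ≤ r) :
    |(T⁻¹ • p) 0| ≤ 1 ∧ |(T⁻¹ • p) 2| ≤ 1 ∧ OnCone (1 - |(T⁻¹ • p) 0|) (T⁻¹ • p) := by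
  have hTi : 0 < T⁻¹ := inv_pos.2 hpos
  have hq := (onCone_smul_iff hTi).2 hp
  set q := T⁻¹ • p with hqdef
  set ρ := T⁻¹ * r with hρdef
  have hρ : 0 ≤ ρ := mul_nonneg hTi.le hr
  have hmax : max (|q 0| + ρ) |q 2| = 1 := by
    have h0 : |q 0| = T⁻¹ * |p 0| := by
      rw [hqdef, PiLp.smul_apply, smul_eq_mul, abs_mul, abs_of_pos hTi]
    have h2 : |q 2| = T⁻¹ * |p 2| := by
      rw [hqdef, PiLp.smul_apply, smul_eq_mul, abs_mul, abs_of_pos hTi]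
    rw [h0, h2, hρdef, ← mul_add, ← mul_max_of_nonneg _ _ hTi.le, ← hT, inv_mul_cancel₀ hpos.ne']
  have h0 : |q 0| + ρ ≤ 1 := hmax ▸ le_max_left _ _
  have h2 : |q 2| ≤ 1 := hmax ▸ le_max_right _ _
  refine ⟨by linarith, h2, ?_⟩
  rcases h0.eq_or_lt with h | h
  · rwa [← h, add_sub_cancel_left]
  -- Here `|z|` attains the maximum and the point is on a flat wedge: `y = 0`, and the equation
  -- still holds with the larger parameter `1 - |q 0|`.
  · have h2' : |q 2| = 1 := by
      rcases max_choice (|q 0| + ρ) |q 2| with e | e <;> linarith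
    unfold OnCone at hq ⊢
    rw [h2'] at hq ⊢
    rw [(fold_eq_zero_iff (le_max_right _ _)).2 (le_max_of_le_left (by linarith))] at hq
    rw [hq, eq_comm, fold_eq_zero_iff (le_max_right _ _)]
    exact le_max_of_le_left (by linarith)

lemma max_pos_of_onCone_zero {u : EuclideanSpace ℝ (Fin 3)} (hu : u ≠ 0) (h : OnCone 0 u) :
    0 < max |u 0| |u 2| := by
  by_contra! hc
  have h0 : u 0 = 0 := abs_nonpos_iff.1 ((le_max_left _ _).trans hc)
  have h2 : u 2 = 0 := abs_nonpos_iff.1 ((le_max_right _ _).trans hc)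
  unfold OnCone at h
  rw [h0, fold_zero] at h
  apply hu
  ext i
  fin_cases i
  exacts [h0, h, h2]

lemma mem_boundedRepresentation_iff {q : EuclideanSpace ℝ (Fin 3)} :
    q ∈ boundedRepresentation body direction ↔
      |q 0| ≤ 1 ∧ |q 2| ≤ 1 ∧ OnCone (1 - |q 0|) q := by
  constructor
  · rintro (⟨p, hp, rfl⟩ | ⟨u, hu, rfl⟩)
    · have hp' := mem_bisector_iff.1 hp
      have hg := gauge_body_sub_direction hp'
      exact smul_onCone_of_pos hp' hg
        (hg ▸ lt_max_of_lt_left (by positivity)) zero_le_one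
    · obtain ⟨hn, hu'⟩ := mem_idealPoints_iff.1 hu
      have hg := gauge_body_of_onCone_zero hu'
      refine smul_onCone_of_pos hu' (by rw [hg, add_zero]) ?_ le_rfl
      rw [hg]
      exact max_pos_of_onCone_zero (by rintro rfl; simp at hn) hu'
  · rintro ⟨h0, h2, h⟩
    rcases h0.lt_or_eq with hlt | heq
    · have hρ : 0 < 1 - |q 0| := by linarith
      set ρ := 1 - |q 0|
      have hi : 0 < ρ⁻¹ := inv_pos.2 hρ
      have hb : OnCone 1 (ρ⁻¹ • q) := by
        have := (onCone_smul_iff hi).2 h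
        rwa [inv_mul_cancel₀ hρ.ne'] at this
      refine Or.inl ⟨ρ⁻¹ • q, mem_bisector_iff.2 hb, ?_⟩
      have hg : gauge body (ρ⁻¹ • q - direction) = ρ⁻¹ := by
        rw [gauge_body_sub_direction hb]
        simp only [PiLp.smul_apply, smul_eq_mul, abs_mul, abs_of_pos hi]
        have : ρ⁻¹ * |q 0| + 1 = ρ⁻¹ := by
          field_simp
          simp [ρ]
        rw [this, max_eq_left (mul_le_of_le_one_right hi.le h2)]
      simp only [hg, smul_smul, inv_inv, mul_inv_cancel₀ hρ.ne', one_smul]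
    · rw [heq, sub_self] at h
      have hq : q ≠ 0 := by
        rintro rfl
        simp at heq
      have hn : 0 < ‖q‖ := norm_pos_iff.2 hq
      have hi : 0 < ‖q‖⁻¹ := inv_pos.2 hn
      have hu : OnCone 0 (‖q‖⁻¹ • q) := by
        have := (onCone_smul_iff hi).2 h
        rwa [mul_zero] at this
      refine Or.inr ⟨‖q‖⁻¹ • q, mem_idealPoints_iff.2
        ⟨by rw [norm_smul, norm_inv, norm_norm, inv_mul_cancel₀ hn.ne'], hu⟩, ?_⟩
      have hg : gauge body (‖q‖⁻¹ • q) = ‖q‖⁻¹ := by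
        rw [gauge_body_of_onCone_zero hu]
        simp only [PiLp.smul_apply, smul_eq_mul, abs_mul, abs_of_pos hi]
        rw [heq, mul_one, max_eq_left (mul_le_of_le_one_right hi.le h2)]
      simp only [hg, smul_smul, inv_inv, mul_inv_cancel₀ hn.ne', one_smul]

/-- The square `[-1, 1]²`. -/
def square : Set (EuclideanSpace ℝ (Fin 2)) := {q | |q 0| ≤ 1 ∧ |q 1| ≤ 1}

lemma exists_homeomorph_square :
    Nonempty (square ≃ₜ closedBall (0 : EuclideanSpace ℝ (Fin 2)) 1) := by
  have hconv : Convex ℝ square := by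
    rintro p ⟨hp0, hp1⟩ q ⟨hq0, hq1⟩ a b ha hb hab
    rw [abs_le] at hp0 hp1 hq0 hq1
    refine ⟨abs_le.2 ⟨?_, ?_⟩, abs_le.2 ⟨?_, ?_⟩⟩ <;>
    simp only [PiLp.add_apply, PiLp.smul_apply, smul_eq_mul] <;> nlinarith
  have hclosed : IsClosed square := by
    simp only [square, ofPred_and]
    refine (isClosed_le ?_ ?_).inter (isClosed_le ?_ ?_) <;> fun_prop
  have hbdd : Bornology.IsBounded square := by
    refine isBounded_iff_forall_norm_le.2 ⟨√2, ?_⟩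
    rintro p ⟨h0, h1⟩
    rw [EuclideanSpace.norm_eq, Fin.sum_univ_two]
    apply Real.sqrt_le_sqrt
    simp only [Real.norm_eq_abs]
    nlinarith [abs_nonneg (p 0), abs_nonneg (p 1)]
  have hint : (interior square).Nonempty := by
    refine ⟨0, mem_interior_iff_mem_nhds.2 ?_⟩
    filter_upwards [closedBall_mem_nhds (0 : EuclideanSpace ℝ (Fin 2)) one_pos] with p hp
    rw [mem_closedBall_zero_iff] at hp
    exact ⟨(PiLp.norm_apply_le p 0).trans hp, (PiLp.norm_apply_le p 1).trans hp⟩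
  obtain ⟨e, -, he, -⟩ :=
    exists_homeomorph_image_interior_closure_frontier_eq_unitBall hconv hint hbdd
  rw [hclosed.closure_eq] at he
  exact ⟨(e.image square).trans (Homeomorph.setCongr he)⟩

lemma boundedRepresentation_homeomorph_disc :
    Nonempty (boundedRepresentation body direction ≃ₜ
      closedBall (0 : EuclideanSpace ℝ (Fin 2)) 1) := by
  obtain ⟨e⟩ := exists_homeomorph_square
  refine ⟨(graphHomeomorph square _ (fun q => fold (q 0) (max (|q 1| - (1 - |q 0|)) 0))
    (by unfold fold; fun_prop) fun p => ?_).trans e⟩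
  rw [mem_boundedRepresentation_iff, ← and_assoc]
  rfl

end BoundedRepresentation

/-! ### The radial projection is not a manifold -/

section RadialProjection

lemma mem_radialProjection_iff {y : EuclideanSpace ℝ (Fin 3)} :
    y ∈ radialProjection body direction ↔ gauge body y = 1 ∧ ∃ r : ℝ, 0 < r ∧ OnCone r y := by
  refine and_congr_right fun _ => ⟨?_, ?_⟩
  · rintro ⟨t, ht, h⟩
    exact ⟨t⁻¹, inv_pos.2 ht, (smul_mem_bisector_iff ht).1 h⟩
  · rintro ⟨r, hr, h⟩
    exact ⟨r⁻¹, inv_pos.2 hr, (smul_mem_bisector_iff (inv_pos.2 hr)).2 (by rwa [inv_inv])⟩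

lemma radialProjection_subset :
    radialProjection body direction ⊆ {y | gauge body y = 1 ∧ ∃ r : ℝ, OnCone r y} := by
  intro y hy
  obtain ⟨h, r, -, hr⟩ := mem_radialProjection_iff.1 hy
  exact ⟨h, r, hr⟩

/-- The ideal points only add the value `r = 0`. The cut-point argument works for any real `r`, so
one superset serves both projections. -/
lemma closedRadialProjection_subset :
    closedRadialProjection body direction ⊆ {y | gauge body y = 1 ∧ ∃ r : ℝ, OnCone r y} := by
  refine union_subset radialProjection_subset ?_
  rintro y ⟨hy, hu⟩
  have hy' : gauge body y = 1 := hy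
  refine ⟨hy', 0, ?_⟩
  have hn : 0 < ‖y‖ := by
    refine norm_pos_iff.2 ?_
    rintro rfl
    simp at hy'
  have := (mem_idealPoints_iff.1 hu).2
  rwa [← mul_zero ‖y‖⁻¹, onCone_smul_iff (inv_pos.2 hn)] at this

lemma horizontal_mem_radialProjection {s : ℝ} (hs : |s| < 1) :
    !₂[s, 0, 1] ∈ radialProjection body direction := by
  rw [mem_radialProjection_iff]
  refine ⟨?_, 1 - |s|, by linarith, ?_⟩
  · rw [gauge_body_of_eq_zero (by simp)]
    simpa using hs.le
  · have : fold s |s| = 0 := (fold_eq_zero_iff (abs_nonneg s)).2 le_rfl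
    simp [OnCone, this]

lemma gauge_body_pos {v : EuclideanSpace ℝ (Fin 3)} (hv : v ≠ 0) : 0 < gauge body v :=
  (gauge_pos (absorbent_nhds_zero body_mem_nhds_zero)
    (NormedSpace.isVonNBounded_of_isBounded ℝ isCompact_body.isBounded)).2 hv

/-- The radial projection of the plane `z = 1` to the unit sphere. -/
noncomputable def patch (p : ℝ × ℝ) : EuclideanSpace ℝ (Fin 3) :=
  (gauge body !₂[p.1, p.2, 1])⁻¹ • !₂[p.1, p.2, 1]

lemma gauge_body_patch_pos (p : ℝ × ℝ) : 0 < gauge body !₂[p.1, p.2, 1] :=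
  gauge_body_pos fun h => by simpa using congrArg (fun v : EuclideanSpace ℝ (Fin 3) => v 2) h

lemma continuous_patch : Continuous patch := by
  have h : Continuous fun p : ℝ × ℝ => (!₂[p.1, p.2, 1] : EuclideanSpace ℝ (Fin 3)) := by
    fun_prop
  exact ((continuous_gauge_body.comp h).inv₀ fun p => (gauge_body_patch_pos p).ne').smul h

lemma injective_patch : Function.Injective patch := by
  intro p p' h
  have hc : ∀ i, patch p i = patch p' i := fun i => by rw [h]
  have h0 := hc 0
  have h1 := hc 1
  have h2 := hc 2
  simp only [patch, PiLp.smul_apply, smul_eq_mul] at h0 h1 h2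
  simp at h2
  rw [← h2] at h0 h1
  have hg := (gauge_body_patch_pos p).ne'
  ext
  · simpa [hg] using h0
  · simpa [hg] using h1

lemma patch_mem_radialProjection {p : ℝ × ℝ} (h0 : 0 < p.2) (h1 : p.2 < p.1) (h2 : p.1 < 1) :
    patch p ∈ radialProjection body direction := by
  have hg := gauge_body_patch_pos p
  have hi := inv_pos.2 hg
  rw [mem_radialProjection_iff]
  have hsq : √(p.1 ^ 2 - p.2 ^ 2) < 1 := by
    rw [Real.sqrt_lt' one_pos]
    nlinarith
  -- At height `z = 1` the equation `x² = y² + (1 - r)²` is solved for `r`, then rescaled.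
  refine ⟨?_, (gauge body !₂[p.1, p.2, 1])⁻¹ * (1 - √(p.1 ^ 2 - p.2 ^ 2)),
    mul_pos hi (by linarith), (onCone_smul_iff hi).2 ?_⟩
  · rw [patch, gauge_smul_of_nonneg hi.le, smul_eq_mul, inv_mul_cancel₀ hg.ne']
  · change p.2 = fold p.1 (max (|1| - (1 - √(p.1 ^ 2 - p.2 ^ 2))) 0)
    rw [abs_one, sub_sub_cancel, max_eq_left (Real.sqrt_nonneg _), eq_fold_iff_of_pos h0,
      Real.sq_sqrt (by nlinarith)]
    exact ⟨by linarith, by ring⟩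

/-- At `x = 0` the equation gives `y = 0` whatever `r` is, and the norm fixes `z`. Hence `(0, 0, 1)`
alone separates `x > 0` from `x < 0` within `z > 0`. -/
lemma eq_of_onCone_of_eq_zero {r : ℝ} {y : EuclideanSpace ℝ (Fin 3)} (hg : gauge body y = 1)
    (h : OnCone r y) (h0 : y 0 = 0) (h2 : 0 < y 2) : y = !₂[0, 0, 1] := by
  unfold OnCone at h
  rw [h0, fold_zero] at h
  rw [gauge_body_of_eq_zero h, h0, abs_zero, abs_of_pos h2, max_eq_right h2.le] at hg
  ext i
  fin_cases i
  exacts [h0, h, hg]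

lemma not_isTopManifoldOfSomeKind_of_subset {R : Set (EuclideanSpace ℝ (Fin 3))}
    (hR : radialProjection body direction ⊆ R)
    (hR' : R ⊆ {y | gauge body y = 1 ∧ ∃ r : ℝ, OnCone r y}) : ¬ IsTopManifoldOfSomeKind R := by
  have hmem : ∀ s : ℝ, |s| < 1 → (!₂[s, 0, 1] : EuclideanSpace ℝ (Fin 3)) ∈ R :=
    fun s hs => hR (horizontal_mem_radialProjection hs)
  have hcont : Continuous fun s : ℝ => (!₂[s, 0, 1] : EuclideanSpace ℝ (Fin 3)) := by fun_prop
  have hsmall : ∀ᶠ s : ℝ in 𝓝 0, |s| < 1 :=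
    continuous_abs.continuousAt.eventually_lt continuousAt_const (by simp)
  set q : R := ⟨!₂[0, 0, 1], hmem 0 (by simp)⟩
  have hcoord : ∀ i : Fin 3, Continuous fun y : R => y.1 i := fun i => by fun_prop
  classical
  refine not_isTopManifoldOfSomeKind (q := q) (W := {y | 0 < y.1 2}) (A := {y | 0 < y.1 0})
    (B := {y | y.1 0 < 0}) ?_ (isOpen_lt continuous_const (hcoord 0))
    (isOpen_lt (hcoord 0) continuous_const) ?_ ?_ ?_ ?_
    (U := {p | 0 < p.2 ∧ p.2 < p.1 ∧ p.1 < 1}) ?_ ⟨(1 / 2, 1 / 4), by norm_num⟩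
    -- The default `q` is never taken on the chosen open triangle.
    (f := fun p => if h : patch p ∈ R then ⟨patch p, h⟩ else q) ?_ ?_
  · exact (isOpen_lt continuous_const (hcoord 2)).mem_nhds (by simp [q])
  · exact disjoint_left.2 fun y (hy : 0 < y.1 0) (hy' : y.1 0 < 0) => lt_asymm hy hy'
  · rintro y ⟨hy2, hyq⟩
    rcases lt_trichotomy (y.1 0) 0 with h | h | h
    · exact Or.inr h
    · obtain ⟨hg, r, hr⟩ := hR' y.2
      exact absurd (Subtype.ext (eq_of_onCone_of_eq_zero hg hr h hy2)) hyq
    · exact Or.inl h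
  · rw [closure_subtype]
    refine mem_closure_of_tendsto (hcont.continuousWithinAt (s := Ioi 0) (x := 0)).tendsto ?_
    filter_upwards [self_mem_nhdsWithin, nhdsWithin_le_nhds hsmall] with s hs hs'
    exact ⟨⟨_, hmem s hs'⟩, hs, rfl⟩
  · rw [closure_subtype]
    refine mem_closure_of_tendsto (hcont.continuousWithinAt (s := Iio 0) (x := 0)).tendsto ?_
    filter_upwards [self_mem_nhdsWithin, nhdsWithin_le_nhds hsmall] with s hs hs'
    exact ⟨⟨_, hmem s hs'⟩, hs, rfl⟩
  · simp only [ofPred_and]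
    refine (isOpen_lt ?_ ?_).inter ((isOpen_lt ?_ ?_).inter (isOpen_lt ?_ ?_)) <;> fun_prop
  · refine Topology.IsInducing.subtypeVal.continuousOn_iff.2 ?_
    refine continuous_patch.continuousOn.congr fun p hp => ?_
    simp [hR (patch_mem_radialProjection hp.1 hp.2.1 hp.2.2)]
  · intro p hp p' hp' h
    have h1 := hR (patch_mem_radialProjection hp.1 hp.2.1 hp.2.2)
    have h2 := hR (patch_mem_radialProjection hp'.1 hp'.2.1 hp'.2.2)
    simp only [h1, h2, dif_pos] at h
    exact injective_patch (congrArg Subtype.val h)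

end RadialProjection

end MinkowskiBisector

theorem mainTheorem6 :
    -- `body` is a centrally symmetric convex body and `direction` is on its unit sphere
    (Convex ℝ MinkowskiBisector.body ∧ IsCompact MinkowskiBisector.body ∧
      (interior MinkowskiBisector.body).Nonempty ∧
      (∀ p ∈ MinkowskiBisector.body, -p ∈ MinkowskiBisector.body) ∧
      MinkowskiBisector.direction ∈
        MinkowskiBisector.unitSphere MinkowskiBisector.body) ∧
    -- the ordinary points of the bisector form a 2-manifold
    MinkowskiBisector.IsTopManifold 2
      (MinkowskiBisector.bisector MinkowskiBisector.body MinkowskiBisector.direction) ∧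
    -- the bisector with its ideal points is a 2-manifold with boundary, and its boundary
    -- consists of the ideal points, of which there are some
    MinkowskiBisector.IsTopManifoldWithBoundary 2
      (MinkowskiBisector.closedBisector MinkowskiBisector.body MinkowskiBisector.direction)
      {p | (p : EuclideanSpace ℝ (Fin 3)) ∈
        MinkowskiBisector.idealPoints MinkowskiBisector.body MinkowskiBisector.direction} ∧
    (MinkowskiBisector.idealPoints
      MinkowskiBisector.body MinkowskiBisector.direction).Nonempty ∧
    -- the bounded representation is a closed disc
    Nonempty
      (MinkowskiBisector.boundedRepresentation
          MinkowskiBisector.body MinkowskiBisector.direction ≃ₜ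
        Metric.closedBall (0 : EuclideanSpace ℝ (Fin 2)) 1) ∧
    -- the radial projection is not a topological manifold, with or without the ideal points
    ¬ MinkowskiBisector.IsTopManifoldOfSomeKind
      (MinkowskiBisector.radialProjection
        MinkowskiBisector.body MinkowskiBisector.direction) ∧
    ¬ MinkowskiBisector.IsTopManifoldOfSomeKind
      (MinkowskiBisector.closedRadialProjection
        MinkowskiBisector.body MinkowskiBisector.direction) := by
  open MinkowskiBisector in
  exact ⟨⟨convex_body, isCompact_body, interior_body_nonempty, fun _ => neg_mem_body,
    direction_mem_unitSphere⟩, isTopManifold_bisector, isTopManifoldWithBoundary_closedBisector,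
    idealPoints_nonempty, boundedRepresentation_homeomorph_disc,
    not_isTopManifoldOfSomeKind_of_subset Subset.rfl radialProjection_subset,
    not_isTopManifoldOfSomeKind_of_subset subset_union_left closedRadialProjection_subset⟩
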